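/- For a finite graph $G=(V,E)$ and an injective map $A=(a_v)_{v\in V}$ of $V$ into $\mathbb Z$, let $A+_G A=\{a_u+a_v : uv\in E\}$ and $A\times_G A=\{a_u a_v : uv\in E\}$, and let $SP_{\mathbb Z}(G)$ be the smallest possible value of $\max\{|A+_G A|,\,|A\times_G A|\}$ over all injections $A:V\to\mathbb Z$. A matching of size $n$ is a graph consisting of $n$ pairwise disjoint edges (on $2n$ vertices), and $K_n$ is the complete graph on $n$ vertices. 1. There is an absolute constant $C>0$ such that for every $n\ge 2$ and every matching $M$ of size $n$, $$SP_{\mathbb Z}(M)\le C\,\frac{SP_{\mathbb Z}(K_n)}{\sqrt n}.$$ 2. There is an absolute constant $\varepsilon>0$ such that for every $n\ge 2$ and every matching $M$ of size $n$, $$SP_{\mathbb Z}(M)\le \frac{n}{(\log n)^{\varepsilon}}.$$ 3. Let $\delta>0$. Suppose that there are $c>0$ and $n_0$ such that $SP_{\mathbb Z}(M)\ge c\,n^{1/2+\delta}$ for every $n\ge n_0$ and every matching $M$ of size $n$. Then there is $c'>0$ such that for every $n$ every $n$-element set $A\subset\mathbb Z$ satisfies $$\max\{|A+A|,\,|A\cdot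 A|\}\ge c'\,n^{1+\delta},$$ where $A+A=\{x+y:x,y\in A\}$ and $A\cdot A=\{xy:x,y\in A\}$. -/

import Mathlib

open scoped Pointwise

universe u

/-- The sum-set of `A : V → R` along the edges of the graph `G`. -/
def graphSumSet {V R : Type*} [CommRing R] (G : SimpleGraph V) (A : V → R) : Set R :=
  {x | ∃ u v, G.Adj u v ∧ x = A u + A v}

/-- The product-set of `A : V → R` along the edges of the graph `G`. -/
def graphProdSet {V R : Type*} [CommRing R] (G : SimpleGraph V) (A : V → R) : Set R :=
  {x | ∃ u v, G.Adj u v ∧ x = A u * A v}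

/-- The sum-product of a finite graph `G` over `R`: the least value of the larger of the sizes of
the sum-set and the product-set along `G`, over all injective maps of the vertices into `R`. -/
noncomputable def SP (R : Type*) [CommRing R] {V : Type*} (G : SimpleGraph V) : ℕ :=
  sInf {m : ℕ | ∃ A : V → R, Function.Injective A ∧
    m = max (graphSumSet G A).ncard (graphProdSet G A).ncard}

/-- `G` is a matching of size `n`: it consists of exactly `n` disjoint edges, that is, every vertex
lies on exactly one edge, and there are `n` edges (so there are `2 * n` vertices). -/
def IsMatchingOfSize {V : Type*} (G : SimpleGraph V) (n : ℕ) : Prop :=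
  (⊤ : G.Subgraph).IsMatching ∧ G.edgeSet.encard = n

/-! A dense graph on a set `A` of nonzero integers contains a matching of size linear in `|A|` with
few sums and few products. Keep each sum with probability `p` and each product with probability `q`,
independently, and retain the edges whose sum and product both survive. Two distinct edges sharing a
vertex have different sums and different products, so both survive with probability exactly
`(pq)^2`. With `pq` about `1/|A|`, deleting the surviving edges that meet another one costs at most
half of the expected number, while the sums and products shrink by factors `p` and `q`. This is
`exists_disjointPairs`.

For a near-optimal embedding of `K_n`, the choice `p = q ≍ n^(-1/2)` saves a factor `√n` on both
sides; dilating the matching by powers of a large integer then restores its size to `n`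
(`exists_dilated_disjointPairs`). The third claim follows by applying this bound to an arbitrary
set.

For the logarithmic saving, take `A = {1, …, N}` with `N ≍ n`: there are at most `2N` sums, and by a
form of Erdős's multiplication table theorem (`exists_dense_graph_few_products`) a positive
proportion of the pairs has only `N²/L²` products, with `L` a power of `log N`. The unbalanced
choice `p = 1/L`, `q ≍ L/N` makes both counts `O(N/L)`. -/

/-- A finite set of pairs of integers, no two coordinates of which coincide. -/
def DisjointPairs (M : Finset (ℤ × ℤ)) : Prop :=
  (∀ e ∈ M, e.1 ≠ e.2) ∧
    ∀ e ∈ M, ∀ f ∈ M, e ≠ f → e.1 ≠ f.1 ∧ e.1 ≠ f.2 ∧ e.2 ≠ f.1 ∧ e.2 ≠ f.2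

/-- The set of sums of the pairs in `M`. -/
def pairSums (M : Finset (ℤ × ℤ)) : Finset ℤ := M.image fun e => e.1 + e.2

/-- The set of products of the pairs in `M`. -/
def pairProds (M : Finset (ℤ × ℤ)) : Finset ℤ := M.image fun e => e.1 * e.2

/-! ### Random subsets and the first moment method -/

/-- The probability that a random subset of `S`, containing each element independently with
probability `p`, is equal to `T`. -/
noncomputable def subsetWeight {σ : Type*} [DecidableEq σ] (p : ℝ) (S T : Finset σ) : ℝ :=
  p ^ T.card * (1 - p) ^ (S \ T).card

/-- The indicator of `B ⊆ T`. -/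
noncomputable def subsetInd {σ : Type*} [DecidableEq σ] (B T : Finset σ) : ℝ :=
  if B ⊆ T then 1 else 0

lemma sum_subsetWeight_mul_ind {σ : Type*} [DecidableEq σ] (p : ℝ) {S B : Finset σ}
    (hB : B ⊆ S) :
    ∑ T ∈ S.powerset, subsetWeight p S T * subsetInd B T = p ^ B.card := by
  -- Expanding this product over subsets gives the weighted sum: elements of `B` contribute only
  -- `p`, the others `p + (1 - p) = 1`.
  have h := Finset.prod_add (fun _ : σ => p) (fun i => if i ∈ B then 0 else 1 - p) S
  have h1 : ∏ i ∈ S, (p + if i ∈ B then 0 else 1 - p) = p ^ B.card := by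
    have : ∀ i ∈ S, (p + if i ∈ B then 0 else 1 - p) = if i ∈ B then p else 1 := by
      intro i _
      split_ifs <;> ring
    rw [Finset.prod_congr rfl this, Finset.prod_ite_mem, Finset.inter_eq_right.2 hB,
      Finset.prod_const]
  rw [← h1, h]
  refine Finset.sum_congr rfl fun T hT => ?_
  rw [Finset.prod_const, subsetWeight, subsetInd, mul_assoc]
  congr 1
  split_ifs with hBT
  · rw [mul_one, ← Finset.prod_const]
    refine Finset.prod_congr rfl fun i hi => ?_
    rw [if_neg fun hiB => (Finset.mem_sdiff.1 hi).2 (hBT hiB)]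
  · obtain ⟨i, hiB, hiT⟩ := Finset.not_subset.1 hBT
    rw [mul_zero, Finset.prod_eq_zero (Finset.mem_sdiff.2 ⟨hB hiB, hiT⟩)]
    exact if_pos hiB

lemma sum_subsetWeight {σ : Type*} [DecidableEq σ] (p : ℝ) (S : Finset σ) :
    ∑ T ∈ S.powerset, subsetWeight p S T = 1 := by
  simpa [subsetInd] using sum_subsetWeight_mul_ind p (Finset.empty_subset S)

lemma exists_le_of_weighted_sum {ι : Type*} (s : Finset ι) (w X : ι → ℝ) (c : ℝ)
    (hw : ∀ i ∈ s, 0 ≤ w i) (hw1 : ∑ i ∈ s, w i = 1) (hc : c ≤ ∑ i ∈ s, w i * X i) :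
    ∃ i ∈ s, c ≤ X i := by
  by_contra! hX
  obtain ⟨i, hi, hwi⟩ : ∃ i ∈ s, 0 < w i := by
    by_contra! h
    linarith [Finset.sum_nonpos h]
  have : ∑ i ∈ s, w i * X i < ∑ i ∈ s, w i * c :=
    Finset.sum_lt_sum (fun j hj => mul_le_mul_of_nonneg_left (hX j hj).le (hw j hj))
      ⟨i, hi, mul_lt_mul_of_pos_left (hX i hi) hwi⟩
  rw [← Finset.sum_mul, hw1, one_mul] at this
  linarith

/-- First moment method for a random choice of a set of sums and a set of products. -/
lemma exists_sparse_labels {E σ τ : Type*} [DecidableEq σ] [DecidableEq τ]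
    (H : Finset E) (D : Finset (E × E)) (S : Finset σ) (P : Finset τ) (s : E → σ) (t : E → τ)
    (hs : ∀ e ∈ H, s e ∈ S) (ht : ∀ e ∈ H, t e ∈ P)
    (hD : ∀ d ∈ D, d.1 ∈ H ∧ d.2 ∈ H ∧ s d.1 ≠ s d.2 ∧ t d.1 ≠ t d.2)
    {p q : ℝ} (hp : 0 ≤ p) (hp1 : p ≤ 1) (hq : 0 ≤ q) (hq1 : q ≤ 1) (α β : ℝ) :
    ∃ T ⊆ S, ∃ U ⊆ P,
      H.card * (p * q) - D.card * (p * q) ^ 2 - α * (S.card * p) - β * (P.card * q) ≤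
        ((H.filter fun e => s e ∈ T ∧ t e ∈ U).card : ℝ) -
          (D.filter fun d => (s d.1 ∈ T ∧ t d.1 ∈ U) ∧ s d.2 ∈ T ∧ t d.2 ∈ U).card -
          α * T.card - β * U.card := by
  set w : Finset σ × Finset τ → ℝ := fun x => subsetWeight p S x.1 * subsetWeight q P x.2 with hw
  -- Factors `subsetInd ∅`, identically 1, give all four terms the shape covered by `key`. The
  -- weights `α`, `β` let one inequality control the edge count and both label sets for the same
  -- outcome.
  set X : Finset σ × Finset τ → ℝ := fun x =>
    ∑ e ∈ H, subsetInd {s e} x.1 * subsetInd {t e} x.2 -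
    ∑ d ∈ D, subsetInd {s d.1, s d.2} x.1 * subsetInd {t d.1, t d.2} x.2 -
    α * ∑ i ∈ S, subsetInd {i} x.1 * subsetInd ∅ x.2 -
    β * ∑ j ∈ P, subsetInd ∅ x.1 * subsetInd {j} x.2 with hX
  have key : ∀ B ⊆ S, ∀ B' ⊆ P,
      ∑ x ∈ S.powerset ×ˢ P.powerset, w x * (subsetInd B x.1 * subsetInd B' x.2) =
        p ^ B.card * q ^ B'.card := by
    intro B hB B' hB'
    rw [← sum_subsetWeight_mul_ind p hB, ← sum_subsetWeight_mul_ind q hB', Finset.sum_mul_sum,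
      Finset.sum_product]
    refine Finset.sum_congr rfl fun i _ => Finset.sum_congr rfl fun j _ => ?_
    simp only [hw]
    ring
  have hE : ∑ x ∈ S.powerset ×ˢ P.powerset, w x * X x =
      H.card * (p * q) - D.card * (p * q) ^ 2 - α * (S.card * p) - β * (P.card * q) := by
    have e1 : ∑ e ∈ H, ∑ x ∈ S.powerset ×ˢ P.powerset,
        w x * (subsetInd {s e} x.1 * subsetInd {t e} x.2) = H.card * (p * q) := by
      rw [← nsmul_eq_mul, ← Finset.sum_const]
      refine Finset.sum_congr rfl fun e he => ?_
      rw [key _ (by simpa using hs e he) _ (by simpa using ht e he)]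
      simp
    have e2 : ∑ d ∈ D, ∑ x ∈ S.powerset ×ˢ P.powerset,
        w x * (subsetInd {s d.1, s d.2} x.1 * subsetInd {t d.1, t d.2} x.2) =
          D.card * (p * q) ^ 2 := by
      rw [← nsmul_eq_mul, ← Finset.sum_const]
      refine Finset.sum_congr rfl fun d hd => ?_
      obtain ⟨h1, h2, h3, h4⟩ := hD d hd
      rw [key _ (Finset.insert_subset (hs _ h1) (by simpa using hs _ h2)) _
        (Finset.insert_subset (ht _ h1) (by simpa using ht _ h2)), Finset.card_pair h3,
        Finset.card_pair h4]
      ring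
    have e3 : ∑ i ∈ S, ∑ x ∈ S.powerset ×ˢ P.powerset,
        w x * (subsetInd {i} x.1 * subsetInd ∅ x.2) = S.card * p := by
      rw [← nsmul_eq_mul, ← Finset.sum_const]
      refine Finset.sum_congr rfl fun i hi => ?_
      rw [key _ (by simpa using hi) _ (Finset.empty_subset _)]
      simp
    have e4 : ∑ j ∈ P, ∑ x ∈ S.powerset ×ˢ P.powerset,
        w x * (subsetInd ∅ x.1 * subsetInd {j} x.2) = P.card * q := by
      rw [← nsmul_eq_mul, ← Finset.sum_const]
      refine Finset.sum_congr rfl fun i hi => ?_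
      rw [key _ (Finset.empty_subset _) _ (by simpa using hi)]
      simp
    rw [← e1, ← e2, ← e3, ← e4, Finset.sum_comm, Finset.sum_comm (s := D),
      Finset.sum_comm (s := S), Finset.sum_comm (s := P), Finset.mul_sum, Finset.mul_sum,
      ← Finset.sum_sub_distrib, ← Finset.sum_sub_distrib, ← Finset.sum_sub_distrib]
    refine Finset.sum_congr rfl fun x _ => ?_
    simp only [hX, ← Finset.mul_sum]
    ring
  obtain ⟨⟨T, U⟩, hTU, hle⟩ := exists_le_of_weighted_sum (S.powerset ×ˢ P.powerset) w X _
    (fun x _ => by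
      have h1 := sub_nonneg.2 hp1
      have h2 := sub_nonneg.2 hq1
      simp only [hw, subsetWeight]
      positivity)
    (by
      rw [Finset.sum_product]
      simp only [hw]
      rw [← Finset.sum_mul_sum, sum_subsetWeight, sum_subsetWeight, one_mul])
    hE.symm.le
  rw [Finset.mem_product, Finset.mem_powerset, Finset.mem_powerset] at hTU
  refine ⟨T, hTU.1, U, hTU.2, hle.trans_eq ?_⟩
  have c3 : ∑ i ∈ S, subsetInd {i} T * subsetInd ∅ U = T.card := by
    simp [subsetInd, Finset.inter_eq_right.2 hTU.1]
  have c4 : ∑ j ∈ P, subsetInd ∅ T * subsetInd {j} U = U.card := by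
    simp [subsetInd, Finset.inter_eq_right.2 hTU.2]
  have c1 : ∑ e ∈ H, subsetInd {s e} T * subsetInd {t e} U =
      ((H.filter fun e => s e ∈ T ∧ t e ∈ U).card : ℝ) := by
    rw [Finset.natCast_card_filter]
    refine Finset.sum_congr rfl fun e _ => ?_
    simp only [subsetInd, Finset.singleton_subset_iff]
    split_ifs <;> simp_all
  have c2 : ∑ d ∈ D, subsetInd {s d.1, s d.2} T * subsetInd {t d.1, t d.2} U =
      ((D.filter fun d => (s d.1 ∈ T ∧ t d.1 ∈ U) ∧ s d.2 ∈ T ∧ t d.2 ∈ U).card : ℝ) := by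
    rw [Finset.natCast_card_filter]
    refine Finset.sum_congr rfl fun e _ => ?_
    simp only [subsetInd, Finset.insert_subset_iff, Finset.singleton_subset_iff]
    split_ifs <;> simp_all
  simp only [hX]
  rw [c1, c2, c3, c4]

/-! ### Sparse matchings inside dense graphs -/

/-- Two distinct pairs with a common entry. -/
def PairsMeet (e f : ℤ × ℤ) : Prop :=
  e ≠ f ∧ (e.1 = f.1 ∨ e.1 = f.2 ∨ e.2 = f.1 ∨ e.2 = f.2)

/-- A common entry together with the sum, or with the product when the entry is nonzero, determines
the other entry; the ordering rules out the swapped pair. This is what makes the survival of two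
meeting edges depend on four independent choices. -/
lemma PairsMeet.sum_ne_and_prod_ne {e f : ℤ × ℤ} (h : PairsMeet e f) (he : e.1 < e.2)
    (hf : f.1 < f.2) (he1 : e.1 ≠ 0) (he2 : e.2 ≠ 0) :
    e.1 + e.2 ≠ f.1 + f.2 ∧ e.1 * e.2 ≠ f.1 * f.2 := by
  obtain ⟨a, b⟩ := e
  obtain ⟨c, d⟩ := f
  obtain ⟨hne, h⟩ := h
  simp only [ne_eq, Prod.mk.injEq, not_and] at *
  rcases h with rfl | rfl | rfl | rfl
  · exact ⟨fun h => hne rfl (by omega), fun h => hne rfl (mul_left_cancel₀ he1 h)⟩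
  · refine ⟨fun h => by omega, fun h => ?_⟩
    have := mul_left_cancel₀ he1 (h.trans (mul_comm _ _))
    omega
  · refine ⟨fun h => by omega, fun h => ?_⟩
    have := mul_right_cancel₀ he2 (h.trans (mul_comm _ _))
    omega
  · exact ⟨fun h => hne (by omega) rfl, fun h => hne (mul_right_cancel₀ he2 h) rfl⟩

open Classical in
lemma card_filter_pairsMeet_le (A : Finset ℤ) (H : Finset (ℤ × ℤ))
    (hH : ∀ e ∈ H, e.1 ∈ A ∧ e.2 ∈ A) (e : ℤ × ℤ) :
    (H.filter fun f => PairsMeet e f).card ≤ 4 * A.card := by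
  have hsub : (H.filter fun f => PairsMeet e f) ⊆
      (A.image fun x => (e.1, x)) ∪ (A.image fun x => (x, e.1)) ∪
        ((A.image fun x => (e.2, x)) ∪ (A.image fun x => (x, e.2))) := by
    rintro ⟨c, d⟩ hf
    obtain ⟨hf, -, h⟩ := Finset.mem_filter.1 hf
    obtain ⟨hc, hd⟩ := hH _ hf
    simp only [Finset.mem_union, Finset.mem_image, Prod.mk.injEq]
    rcases h with h | h | h | h
    · exact Or.inl (Or.inl ⟨d, hd, h, rfl⟩)
    · exact Or.inl (Or.inr ⟨c, hc, rfl, h⟩)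
    · exact Or.inr (Or.inl ⟨d, hd, h, rfl⟩)
    · exact Or.inr (Or.inr ⟨c, hc, rfl, h⟩)
  have h1 := Finset.card_le_card hsub
  have h2 := Finset.card_union_le ((A.image fun x => (e.1, x)) ∪ (A.image fun x => (x, e.1)))
    ((A.image fun x => (e.2, x)) ∪ (A.image fun x => (x, e.2)))
  have h3 := Finset.card_union_le (A.image fun x => (e.1, x)) (A.image fun x => (x, e.1))
  have h4 := Finset.card_union_le (A.image fun x => (e.2, x)) (A.image fun x => (x, e.2))
  have i1 := Finset.card_image_le (s := A) (f := fun x => (e.1, x))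
  have i2 := Finset.card_image_le (s := A) (f := fun x => (x, e.1))
  have i3 := Finset.card_image_le (s := A) (f := fun x => (e.2, x))
  have i4 := Finset.card_image_le (s := A) (f := fun x => (x, e.2))
  omega

/-- Of the expected `hpq` edges, meeting pairs cost at most one half and the two penalties one
eighth each, so a quarter remains. Since the matching has at most `a` edges, neither penalty can
exceed `a`, which bounds the numbers of sums and products. -/
lemma sparse_bounds_of_expectation {h a s r p q d m t u x y σ τ : ℝ} (hh : 0 < h) (hs : 0 < s)
    (hr : 0 < r) (hp : 0 < p) (hq : 0 < q) (hpq : 8 * a * (p * q) ≤ 1) (hd : d ≤ h * (4 * a))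
    (hma : m ≤ a) (hσ0 : 0 ≤ σ) (hτ0 : 0 ≤ τ) (hσ : σ ≤ t) (hτ : τ ≤ u) (hxy : x - y ≤ m)
    (hle : h * (p * q) - d * (p * q) ^ 2 - h * q / (8 * s) * (s * p) - h * p / (8 * r) * (r * q) ≤
      x - y - h * q / (8 * s) * t - h * p / (8 * r) * u) :
    h * (p * q) ≤ 4 * m ∧ σ * (h * q) ≤ 8 * a * s ∧ τ * (h * p) ≤ 8 * a * r := by
  have hs' : h * q / (8 * s) * (s * p) = h * (p * q) / 8 := by field_simp
  have hr' : h * p / (8 * r) * (r * q) = h * (p * q) / 8 := by field_simp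
  have hdpq : d * (p * q) ^ 2 ≤ h * (p * q) / 2 := by
    calc d * (p * q) ^ 2 ≤ h * (4 * a) * (p * q) ^ 2 := by gcongr
      _ = h * (p * q) / 2 * (8 * a * (p * q)) := by ring
      _ ≤ h * (p * q) / 2 * 1 := by gcongr
      _ = h * (p * q) / 2 := mul_one _
  have hpos : 0 ≤ h * (p * q) := by positivity
  have h1 : 0 ≤ h * q / (8 * s) * σ := by positivity
  have h2 : 0 ≤ h * p / (8 * r) * τ := by positivity
  have h3 : h * q / (8 * s) * σ ≤ h * q / (8 * s) * t := by gcongr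
  have h4 : h * p / (8 * r) * τ ≤ h * p / (8 * r) * u := by gcongr
  refine ⟨by linarith, ?_, ?_⟩
  · have h5 : h * q / (8 * s) * σ ≤ a := by linarith
    rw [div_mul_eq_mul_div, div_le_iff₀ (by positivity)] at h5
    linarith
  · have h5 : h * p / (8 * r) * τ ≤ a := by linarith
    rw [div_mul_eq_mul_div, div_le_iff₀ (by positivity)] at h5
    linarith

/-- A dense graph on a set of integers contains a large matching whose sums and products lie in
random subsets of the sums and the products of the graph. -/
lemma exists_disjointPairs (A : Finset ℤ) (hA : (0 : ℤ) ∉ A) (H : Finset (ℤ × ℤ))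
    (hH : ∀ e ∈ H, e.1 ∈ A ∧ e.2 ∈ A ∧ e.1 < e.2) {p q : ℝ} (hp : 0 < p) (hp1 : p ≤ 1)
    (hq : 0 < q) (hq1 : q ≤ 1) (hpq : 8 * A.card * (p * q) ≤ 1) :
    ∃ M ⊆ H, DisjointPairs M ∧ H.card * (p * q) ≤ 4 * M.card ∧
      (pairSums M).card * (H.card * q) ≤ 8 * A.card * ((pairSums H).card : ℝ) ∧
      (pairProds M).card * (H.card * p) ≤ 8 * A.card * ((pairProds H).card : ℝ) := by
  classical
  rcases H.eq_empty_or_nonempty with rfl | hne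
  · exact ⟨∅, by simp, by simp [DisjointPairs], by simp, by simp [pairSums], by simp [pairProds]⟩
  set D := (H ×ˢ H).filter fun d => PairsMeet d.1 d.2 with hDdef
  have hDcard : (D.card : ℝ) ≤ H.card * (4 * A.card) := by
    have : D.card ≤ H.card * (4 * A.card) := by
      rw [hDdef, Finset.card_filter, Finset.sum_product, ← smul_eq_mul, ← Finset.sum_const]
      refine Finset.sum_le_sum fun e _ => ?_
      rw [← Finset.card_filter]
      exact card_filter_pairsMeet_le A H (fun e he => ⟨(hH e he).1, (hH e he).2.1⟩) e
    exact_mod_cast this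
  have hh : (0 : ℝ) < H.card := by exact_mod_cast hne.card_pos
  have hS : (0 : ℝ) < (pairSums H).card := by exact_mod_cast (hne.image _).card_pos
  have hP : (0 : ℝ) < (pairProds H).card := by exact_mod_cast (hne.image _).card_pos
  obtain ⟨T, hT, U, hU, hle⟩ := exists_sparse_labels H D (pairSums H) (pairProds H)
    (fun e => e.1 + e.2) (fun e => e.1 * e.2) (fun e he => Finset.mem_image_of_mem _ he)
    (fun e he => Finset.mem_image_of_mem _ he)
    (fun d hd => by
      obtain ⟨hd, hm⟩ := Finset.mem_filter.1 hd
      obtain ⟨h1, h2⟩ := Finset.mem_product.1 hd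
      obtain ⟨i1, i2, i3⟩ := hH _ h1
      exact ⟨h1, h2, hm.sum_ne_and_prod_ne i3 (hH _ h2).2.2 (fun h => hA (h ▸ i1))
        (fun h => hA (h ▸ i2))⟩) hp.le hp1 hq.le hq1
    -- These weights make each expected penalty equal to `|H|pq/8`.
    (H.card * q / (8 * (pairSums H).card)) (H.card * p / (8 * (pairProds H).card))
  set H' := H.filter fun e => e.1 + e.2 ∈ T ∧ e.1 * e.2 ∈ U with hH'
  set D' := D.filter fun d => (d.1.1 + d.1.2 ∈ T ∧ d.1.1 * d.1.2 ∈ U) ∧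
    d.2.1 + d.2.2 ∈ T ∧ d.2.1 * d.2.2 ∈ U with hD'
  -- Every surviving edge that meets another surviving edge is dropped.
  set M := H' \ D'.image Prod.fst with hM
  have hMH : ∀ e ∈ M, e ∈ H ∧ e.1 + e.2 ∈ T ∧ e.1 * e.2 ∈ U := fun e he =>
    Finset.mem_filter.1 (Finset.mem_sdiff.1 he).1
  have hdis : DisjointPairs M := by
    refine ⟨fun e he => (hH e (hMH e he).1).2.2.ne, fun e he f hf hef => ?_⟩
    by_contra hcon
    refine (Finset.mem_sdiff.1 he).2 (Finset.mem_image.2 ⟨(e, f), ?_, rfl⟩)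
    refine Finset.mem_filter.2 ⟨Finset.mem_filter.2 ⟨Finset.mem_product.2
      ⟨(hMH e he).1, (hMH f hf).1⟩, hef, ?_⟩, (hMH e he).2, (hMH f hf).2⟩
    tauto
  have hMcard : (H'.card : ℝ) - D'.card ≤ M.card := by
    have h1 : H'.card - (D'.image Prod.fst).card ≤ M.card := Finset.le_card_sdiff _ _
    have h2 : (D'.image Prod.fst).card ≤ D'.card := Finset.card_image_le
    have : H'.card ≤ M.card + D'.card := by omega
    have : (H'.card : ℝ) ≤ M.card + D'.card := by exact_mod_cast this
    linarith
  have hMA : (M.card : ℝ) ≤ A.card := by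
    have : M.card ≤ A.card := by
      refine Finset.card_le_card_of_injOn Prod.fst (fun e he => (hH e (hMH e he).1).1) ?_
      intro e he f hf hef
      by_contra h
      exact (hdis.2 e he f hf h).1 hef
    exact_mod_cast this
  have hST : ((pairSums M).card : ℝ) ≤ T.card := by
    have : (pairSums M).card ≤ T.card := Finset.card_le_card
      (Finset.image_subset_iff.2 fun e he => (hMH e he).2.1)
    exact_mod_cast this
  have hPU : ((pairProds M).card : ℝ) ≤ U.card := by
    have : (pairProds M).card ≤ U.card := Finset.card_le_card
      (Finset.image_subset_iff.2 fun e he => (hMH e he).2.2)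
    exact_mod_cast this
  exact ⟨M, fun e he => (hMH e he).1, hdis, sparse_bounds_of_expectation hh hS hP hp hq hpq hDcard hMA (Nat.cast_nonneg _)
    (Nat.cast_nonneg _) hST hPU hMcard hle⟩

/-! ### Prime divisors of typical integers and the multiplication table -/

/-- The number of elements of `Q` that divide `a`. -/
def divisorCountIn (Q : Finset ℕ) (a : ℕ) : ℕ := (Q.filter (· ∣ a)).card

/-- The sum of the reciprocals of the elements of `Q`. -/
noncomputable def recipSum (Q : Finset ℕ) : ℝ := ∑ p ∈ Q, (p : ℝ)⁻¹

lemma recipSum_nonneg (Q : Finset ℕ) : 0 ≤ recipSum Q :=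
  Finset.sum_nonneg fun _ _ => by positivity

/-- A lower bound of Mertens type for the sum of the reciprocals of the primes. -/
lemma log_le_exp_two_mul_recipSum {N : ℕ} (hN : 1 ≤ N) :
    Real.log N ≤ Real.exp (2 * recipSum (N + 1).primesBelow) := by
  let f : ℕ →* ℝ :=
    { toFun := fun m => (m : ℝ)⁻¹
      map_one' := by simp
      map_mul' := fun a b => by push_cast; rw [mul_inv] }
  have hf : ∀ {p : ℕ}, p.Prime → ‖f p‖ < 1 := by
    intro p hp
    have : (1 : ℝ) < p := by exact_mod_cast hp.one_lt
    simpa [f] using inv_lt_one_of_one_lt₀ this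
  obtain ⟨-, hsum⟩ :=
    EulerProduct.summable_and_hasSum_smoothNumbers_prod_primesBelow_geometric hf (N + 1)
  have hmem : ∀ m ∈ Finset.Icc 1 N, m ∈ Nat.smoothNumbers (N + 1) := by
    intro m hm
    rw [Finset.mem_Icc] at hm
    exact Nat.mem_smoothNumbers_of_lt (by omega) (by omega)
  -- All integers up to `N` are products of primes at most `N`, so the Euler product over these
  -- primes dominates the harmonic sum.
  have h1 : ∑ m ∈ Finset.Icc 1 N, (m : ℝ)⁻¹ ≤ ∏ p ∈ (N + 1).primesBelow, (1 - f p)⁻¹ := by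
    have := sum_le_hasSum ((Finset.Icc 1 N).subtype (· ∈ Nat.smoothNumbers (N + 1)))
      (fun m _ => by simp [f]) hsum
    rw [Finset.sum_subtype_of_mem (f := fun m => f m) hmem] at this
    simpa [f] using this
  have h2 : Real.log N ≤ ∑ m ∈ Finset.Icc 1 N, (m : ℝ)⁻¹ := by
    have h := log_add_one_le_harmonic N
    rw [harmonic_eq_sum_Icc] at h
    push_cast at h
    refine le_trans (Real.log_le_log (by exact_mod_cast hN) (by linarith)) h
  refine h2.trans (h1.trans ?_)
  rw [recipSum, Finset.mul_sum, Real.exp_sum]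
  refine Finset.prod_le_prod (fun p hp => ?_) fun p hp => ?_
  · exact inv_nonneg.2 (sub_nonneg.2 ((le_abs_self _).trans (hf (Nat.prime_of_mem_primesBelow hp)).le))
  · have h2 : (2 : ℝ) ≤ p := by exact_mod_cast (Nat.prime_of_mem_primesBelow hp).two_le
    have h3 : (p : ℝ)⁻¹ ≤ 1 / 2 := by
      rw [inv_le_comm₀ (by linarith) (by norm_num)]
      simpa using h2
    have h4 : 0 < (p : ℝ)⁻¹ := by positivity
    have h5 := Real.add_one_le_exp (2 * (p : ℝ)⁻¹)
    -- For `0 < x ≤ 1/2`, `1/(1 - x) ≤ 1 + 2x ≤ exp(2x)`.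
    refine le_trans ?_ h5
    change (1 - (p : ℝ)⁻¹)⁻¹ ≤ _
    rw [inv_le_iff_one_le_mul₀ (by linarith)]
    nlinarith

lemma natCast_card_filter_dvd_le (N d : ℕ) :
    (((Finset.Ioc 0 N).filter (d ∣ ·)).card : ℝ) ≤ N * (d : ℝ)⁻¹ := by
  rw [Nat.Ioc_filter_dvd_card_eq_div, ← div_eq_mul_inv]
  exact Nat.cast_div_le

lemma le_natCast_card_filter_dvd (N : ℕ) (d : ℕ) :
    N * (d : ℝ)⁻¹ - 1 ≤ (((Finset.Ioc 0 N).filter (d ∣ ·)).card : ℝ) := by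
  rw [Nat.Ioc_filter_dvd_card_eq_div, ← div_eq_mul_inv, ← Nat.floor_div_eq_div (K := ℝ)]
  exact (Nat.sub_one_lt_floor _).le

lemma natCast_divisorCountIn (Q : Finset ℕ) (a : ℕ) :
    (divisorCountIn Q a : ℝ) = ∑ p ∈ Q, if p ∣ a then 1 else 0 := by
  rw [divisorCountIn, Finset.natCast_card_filter]

/-- Turán's variance bound. -/
lemma sum_sq_divisorCountIn_sub_le {N : ℕ} {Q : Finset ℕ} (hQ : ∀ p ∈ Q, p.Prime)
    (hcard : Q.card ≤ N) :
    ∑ a ∈ Finset.Ioc 0 N, ((divisorCountIn Q a : ℝ) - recipSum Q) ^ 2 ≤ 3 * N * recipSum Q := by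
  set T := recipSum Q with hT
  have hT0 : 0 ≤ T := recipSum_nonneg Q
  -- Rounding loses at most 1 per prime, hence at most `|Q| ≤ N` in total.
  have h1 : N * T - N ≤ ∑ a ∈ Finset.Ioc 0 N, (divisorCountIn Q a : ℝ) := by
    simp_rw [natCast_divisorCountIn]
    rw [Finset.sum_comm]
    calc N * T - N ≤ N * T - Q.card := by
          have : (Q.card : ℝ) ≤ N := by exact_mod_cast hcard
          linarith
      _ = ∑ p ∈ Q, (N * (p : ℝ)⁻¹ - 1) := by
          rw [Finset.sum_sub_distrib, ← Finset.mul_sum]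
          simp [hT, recipSum]
      _ ≤ _ := by
          refine Finset.sum_le_sum fun p hp => ?_
          rw [← Finset.natCast_card_filter]
          exact le_natCast_card_filter_dvd N p
  have h2 : ∑ a ∈ Finset.Ioc 0 N, (divisorCountIn Q a : ℝ) ^ 2 ≤ N * T + N * T ^ 2 := by
    have e1 : ∀ a, (divisorCountIn Q a : ℝ) ^ 2 =
        ∑ p ∈ Q, ∑ q ∈ Q, if p ∣ a ∧ q ∣ a then 1 else 0 := by
      intro a
      rw [natCast_divisorCountIn, sq, Finset.sum_mul_sum]
      refine Finset.sum_congr rfl fun p _ => Finset.sum_congr rfl fun q _ => ?_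
      split_ifs <;> simp_all
    simp_rw [e1]
    rw [Finset.sum_comm]
    have e2 : ∀ p ∈ Q, ∑ a ∈ Finset.Ioc 0 N, ∑ q ∈ Q, (if p ∣ a ∧ q ∣ a then (1 : ℝ) else 0) ≤
        N * (p : ℝ)⁻¹ + N * (p : ℝ)⁻¹ * T := by
      intro p hp
      rw [Finset.sum_comm, hT, recipSum, Finset.mul_sum]
      -- Distinct primes dividing `a` have their product dividing `a`; the diagonal contributes the
      -- extra `N/p`.
      have e3 : ∀ q ∈ Q, ∑ a ∈ Finset.Ioc 0 N, (if p ∣ a ∧ q ∣ a then (1 : ℝ) else 0) ≤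
          (if p = q then N * (p : ℝ)⁻¹ else 0) + N * (p : ℝ)⁻¹ * (q : ℝ)⁻¹ := by
        intro q hq
        rw [← Finset.natCast_card_filter]
        split_ifs with hpq
        · subst hpq
          simp only [and_self]
          have := natCast_card_filter_dvd_le N p
          have : 0 ≤ N * (p : ℝ)⁻¹ * (p : ℝ)⁻¹ := by positivity
          linarith
        · have hpq' : p.Coprime q := (Nat.coprime_primes (hQ p hp) (hQ q hq)).2 hpq
          have := natCast_card_filter_dvd_le N (p * q)
          push_cast at this
          rw [mul_inv, ← mul_assoc] at this
          rw [zero_add]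
          refine le_trans ?_ this
          exact_mod_cast Finset.card_le_card (Finset.monotone_filter_right _
            fun a _ (h : p ∣ a ∧ q ∣ a) => hpq'.mul_dvd_of_dvd_of_dvd h.1 h.2)
      refine (Finset.sum_le_sum e3).trans_eq ?_
      rw [Finset.sum_add_distrib, Finset.sum_ite_eq, if_pos hp]
    refine (Finset.sum_le_sum e2).trans_eq ?_
    rw [Finset.sum_add_distrib, ← Finset.sum_mul, ← Finset.mul_sum]
    simp only [hT, recipSum]
    ring
  have h3 : ∑ a ∈ Finset.Ioc 0 N, ((divisorCountIn Q a : ℝ) - T) ^ 2 =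
      ∑ a ∈ Finset.Ioc 0 N, (divisorCountIn Q a : ℝ) ^ 2 -
        2 * T * ∑ a ∈ Finset.Ioc 0 N, (divisorCountIn Q a : ℝ) + N * T ^ 2 := by
    have : (N : ℝ) * T ^ 2 = ∑ a ∈ Finset.Ioc 0 N, T ^ 2 := by simp
    rw [this, Finset.mul_sum, ← Finset.sum_sub_distrib, ← Finset.sum_add_distrib]
    exact Finset.sum_congr rfl fun a _ => by ring
  rw [h3]
  have h4 := mul_le_mul_of_nonneg_left h1 (mul_nonneg zero_le_two hT0)
  linarith

/-- Few integers have substantially fewer prime divisors in `Q` than expected. -/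
lemma card_divisorCountIn_lt_le {N : ℕ} {Q : Finset ℕ} (hQ : ∀ p ∈ Q, p.Prime)
    (hcard : Q.card ≤ N) (hT : 0 < recipSum Q) :
    (((Finset.Ioc 0 N).filter fun a => (divisorCountIn Q a : ℝ) < 9 / 10 * recipSum Q).card : ℝ) ≤
      300 * N / recipSum Q := by
  have h := sum_sq_divisorCountIn_sub_le hQ hcard
  set B := (Finset.Ioc 0 N).filter fun a => (divisorCountIn Q a : ℝ) < 9 / 10 * recipSum Q
  -- Chebyshev's inequality with deviation a tenth of the mean.
  have h1 : ∑ a ∈ B, (recipSum Q / 10) ^ 2 ≤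
      ∑ a ∈ Finset.Ioc 0 N, ((divisorCountIn Q a : ℝ) - recipSum Q) ^ 2 := by
    refine (Finset.sum_le_sum fun a ha => ?_).trans
      (Finset.sum_le_sum_of_subset_of_nonneg (Finset.filter_subset _ _) fun a _ _ => sq_nonneg _)
    have := (Finset.mem_filter.1 ha).2
    nlinarith
  rw [Finset.sum_const, nsmul_eq_mul] at h1
  rw [le_div_iff₀ hT]
  have h2 := h1.trans h
  have h3 : (B.card * recipSum Q) * recipSum Q ≤ (300 * N) * recipSum Q := by nlinarith
  exact le_of_mul_le_mul_right h3 hT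

/-- Few pairs of integers have many common prime divisors. -/
lemma card_common_divisorCountIn_le {N : ℕ} {Q : Finset ℕ} (hQ : ∀ p ∈ Q, p.Prime)
    {t : ℝ} (ht : 0 < t) :
    (((Finset.Ioc 0 N ×ˢ Finset.Ioc 0 N).filter fun x =>
      t ≤ ((Q.filter fun p => p ∣ x.1 ∧ p ∣ x.2).card : ℝ)).card : ℝ) ≤ 2 * N ^ 2 / t := by
  set B := (Finset.Ioc 0 N ×ˢ Finset.Ioc 0 N).filter fun x =>
      t ≤ ((Q.filter fun p => p ∣ x.1 ∧ p ∣ x.2).card : ℝ)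
  -- Markov's inequality; the mean is bounded because `∑ 1/p²` converges.
  have h1 : ∑ x ∈ B, t ≤ ∑ x ∈ Finset.Ioc 0 N ×ˢ Finset.Ioc 0 N,
      ((Q.filter fun p => p ∣ x.1 ∧ p ∣ x.2).card : ℝ) :=
    (Finset.sum_le_sum fun x hx => (Finset.mem_filter.1 hx).2).trans
      (Finset.sum_le_sum_of_subset_of_nonneg (Finset.filter_subset _ _)
        fun a _ _ => Nat.cast_nonneg _)
  have h2 : ∑ x ∈ Finset.Ioc 0 N ×ˢ Finset.Ioc 0 N,
      ((Q.filter fun p => p ∣ x.1 ∧ p ∣ x.2).card : ℝ) ≤ ∑ p ∈ Q, N ^ 2 * ((p : ℝ) ^ 2)⁻¹ := by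
    simp_rw [Finset.natCast_card_filter]
    rw [Finset.sum_comm]
    refine Finset.sum_le_sum fun p hp => ?_
    rw [← Finset.natCast_card_filter, Finset.filter_product (p ∣ ·) (p ∣ ·),
      Finset.card_product]
    push_cast
    have := natCast_card_filter_dvd_le N p
    calc _ ≤ (N * (p : ℝ)⁻¹) * (N * (p : ℝ)⁻¹) := by gcongr
      _ = _ := by rw [← inv_pow]; ring
  have h3 : ∑ p ∈ Q, ((p : ℝ) ^ 2)⁻¹ ≤ 2 := by
    have hsub : Q ⊆ Finset.Ioo 0 (Q.sup id + 1) := fun p hp =>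
      Finset.mem_Ioo.2 ⟨(hQ p hp).pos, Nat.lt_succ_of_le (Finset.le_sup (f := id) hp)⟩
    refine (Finset.sum_le_sum_of_subset_of_nonneg hsub fun _ _ _ => by positivity).trans ?_
    simpa using sum_Ioo_inv_sq_le (α := ℝ) 0 (Q.sup id + 1)
  rw [← Finset.mul_sum] at h2
  rw [Finset.sum_const, nsmul_eq_mul] at h1
  rw [le_div_iff₀ ht]
  have := mul_le_mul_of_nonneg_left h3 (sq_nonneg (N : ℝ))
  linarith

/-- Exponential moment of the number of prime divisors. -/
lemma sum_pow_divisorCountIn_le {Q : Finset ℕ} (hQ : ∀ p ∈ Q, p.Prime) (X : ℕ) :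
    ∑ x ∈ Finset.Ioc 0 X, (3 / 2 : ℝ) ^ divisorCountIn Q x ≤ X * Real.exp (recipSum Q / 2) := by
  have h1 : ∀ x, (3 / 2 : ℝ) ^ divisorCountIn Q x ≤
      ∑ D ∈ Q.powerset, if (∏ p ∈ D, p) ∣ x then (1 / 2 : ℝ) ^ D.card else 0 := by
    intro x
    -- Write `(1 + 1/2)^k` as a sum of `(1/2)^|D|` over sets `D` of prime divisors of `x`; the
    -- product of `D` then divides `x`.
    have := Finset.sum_pow_mul_eq_add_pow (1 / 2 : ℝ) 1 (Q.filter (· ∣ x))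
    norm_num only at this
    rw [divisorCountIn, ← this]
    rw [← Finset.sum_filter]
    simp only [one_pow, mul_one]
    refine Finset.sum_le_sum_of_subset_of_nonneg (fun D hD => ?_) fun _ _ _ => by positivity
    rw [Finset.mem_powerset] at hD
    refine Finset.mem_filter.2 ⟨Finset.mem_powerset.2 (hD.trans (Finset.filter_subset _ _)), ?_⟩
    exact Finset.prod_primes_dvd _
      (fun p hp => (hQ p (Finset.mem_filter.1 (hD hp)).1).prime)
      fun p hp => (Finset.mem_filter.1 (hD hp)).2
  refine (Finset.sum_le_sum fun x _ => h1 x).trans ?_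
  rw [Finset.sum_comm]
  have h2 : ∀ D ∈ Q.powerset, ∑ x ∈ Finset.Ioc 0 X,
      (if (∏ p ∈ D, p) ∣ x then (1 / 2 : ℝ) ^ D.card else 0) ≤
        X * ∏ p ∈ D, (1 / 2 * (p : ℝ)⁻¹) := by
    intro D _
    rw [← Finset.sum_filter, Finset.sum_const, nsmul_eq_mul, Finset.prod_mul_distrib,
      Finset.prod_const, Finset.prod_inv_distrib]
    have := natCast_card_filter_dvd_le X (∏ p ∈ D, p)
    push_cast at this
    have h := mul_le_mul_of_nonneg_right this (by positivity : (0 : ℝ) ≤ (1 / 2) ^ D.card)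
    linarith
  refine (Finset.sum_le_sum h2).trans ?_
  rw [← Finset.mul_sum, ← Finset.prod_one_add, recipSum, Finset.sum_div, Real.exp_sum]
  refine mul_le_mul_of_nonneg_left ?_ (Nat.cast_nonneg _)
  refine Finset.prod_le_prod (fun p _ => by positivity) fun p _ => ?_
  have := Real.add_one_le_exp ((p : ℝ)⁻¹ / 2)
  linarith

/-- Few integers have substantially more prime divisors in `Q` than expected. -/
lemma card_le_divisorCountIn_le {Q : Finset ℕ} (hQ : ∀ p ∈ Q, p.Prime) (X : ℕ) :
    (((Finset.Ioc 0 X).filter fun x =>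
      17 / 10 * recipSum Q ≤ (divisorCountIn Q x : ℝ)).card : ℝ) ≤
      X * Real.exp (-(recipSum Q / 6)) := by
  set B := (Finset.Ioc 0 X).filter fun x => 17 / 10 * recipSum Q ≤ (divisorCountIn Q x : ℝ)
  -- With `17/10 · 2/5 = 17/25`, the base `3/2` gains `17/25 - 1/2 = 9/50`, which exceeds `1/6`.
  have hlog : (2 / 5 : ℝ) ≤ Real.log (3 / 2) := by
    have := Real.le_log_one_add_of_nonneg (x := 1 / 2) (by norm_num)
    norm_num at this ⊢
    exact this
  have h1 : ∑ x ∈ B, Real.exp (17 / 25 * recipSum Q) ≤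
      ∑ x ∈ Finset.Ioc 0 X, (3 / 2 : ℝ) ^ divisorCountIn Q x := by
    refine (Finset.sum_le_sum fun x hx => ?_).trans
      (Finset.sum_le_sum_of_subset_of_nonneg (Finset.filter_subset _ _)
        fun _ _ _ => by positivity)
    have hx := (Finset.mem_filter.1 hx).2
    rw [← Real.rpow_natCast, Real.rpow_def_of_pos (by norm_num)]
    refine Real.exp_le_exp.2 ?_
    have hT := recipSum_nonneg Q
    have h0 : 0 ≤ (divisorCountIn Q x : ℝ) := Nat.cast_nonneg _
    nlinarith
  have h2 := h1.trans (sum_pow_divisorCountIn_le hQ X)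
  rw [Finset.sum_const, nsmul_eq_mul] at h2
  have hT := recipSum_nonneg Q
  have h3 : Real.exp (recipSum Q / 2) ≤
      Real.exp (-(recipSum Q / 6)) * Real.exp (17 / 25 * recipSum Q) := by
    rw [← Real.exp_add]
    exact Real.exp_le_exp.2 (by linarith)
  have h4 := h2.trans (mul_le_mul_of_nonneg_left h3 (Nat.cast_nonneg X))
  rw [← mul_assoc] at h4
  exact le_of_mul_le_mul_right h4 (Real.exp_pos _)

/-- Inclusion–exclusion: the only primes counted twice on the left are the common divisors. -/
lemma divisorCountIn_add_le {Q : Finset ℕ} (a b : ℕ) :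
    divisorCountIn Q a + divisorCountIn Q b ≤
      divisorCountIn Q (a * b) + (Q.filter fun p => p ∣ a ∧ p ∣ b).card := by
  simp only [divisorCountIn]
  rw [← Finset.card_union_add_card_inter, ← Finset.filter_and]
  refine Nat.add_le_add_right (Finset.card_le_card ?_) _
  rw [← Finset.filter_or]
  exact Finset.monotone_filter_right _ fun p _ h =>
    h.elim (fun h => h.mul_right _) fun h => h.mul_left _

lemma two_mul_card_filter_lt {α : Type*} [LinearOrder α] (A : Finset α) :
    2 * ((A ×ˢ A).filter fun x => x.1 < x.2).card + A.card = A.card ^ 2 := by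
  have h1 : ((A ×ˢ A).filter fun x => x.2 < x.1).card =
      ((A ×ˢ A).filter fun x => x.1 < x.2).card := by
    refine Finset.card_bij' (fun x _ => x.swap) (fun x _ => x.swap) ?_ ?_ ?_ ?_ <;>
      simp +contextual
  have h2 : ((A ×ˢ A).filter fun x => x.1 = x.2).card = A.card := by
    rw [← Finset.diag_eq_filter, Finset.diag_card]
  have h3 := Finset.card_filter_add_card_filter_not (s := A ×ˢ A) (fun x => x.1 < x.2)
  have h4 : ((A ×ˢ A).filter fun x => ¬ x.1 < x.2) =
      ((A ×ˢ A).filter fun x => x.2 < x.1) ∪ ((A ×ˢ A).filter fun x => x.1 = x.2) := by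
    rw [← Finset.filter_or]
    refine Finset.filter_congr fun x _ => ?_
    rw [not_lt, le_iff_lt_or_eq, eq_comm]
  rw [h4, Finset.card_union_of_disjoint, h1, h2, Finset.card_product] at h3
  · linarith
  · rw [Finset.disjoint_filter]
    exact fun x _ h => h.ne'

/-- A dense graph on `{1, …, N}` with few products: a variant of Erdős's multiplication table
theorem. -/
lemma exists_dense_graph_few_products :
    ∃ N₀ : ℕ, ∀ N : ℕ, N₀ ≤ N → ∃ H : Finset (ℕ × ℕ),
      (∀ e ∈ H, 0 < e.1 ∧ e.1 < e.2 ∧ e.2 ≤ N) ∧ (N : ℝ) ^ 2 / 8 ≤ H.card ∧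
      ((H.image fun e => e.1 * e.2).card : ℝ) ≤ N ^ 2 / (Real.log N ^ (1 / 24 : ℝ)) ^ 2 := by
  -- The double exponential forces `T ≥ 5000`. The exceptional pairs then number at most `(2 · 3/50
  -- + 1/250) N² = 0.124 N²`, while at least `N²/4` pairs are increasing, so more than `N²/8`
  -- remain.
  refine ⟨max 2 ⌈Real.exp (Real.exp 10000)⌉₊, fun N hN => ?_⟩
  have hN2 : 2 ≤ N := (le_max_left _ _).trans hN
  have hNe : Real.exp (Real.exp 10000) ≤ N := Nat.ceil_le.1 ((le_max_right _ _).trans hN)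
  have hN0 : (0 : ℝ) < N := by positivity
  have hlog : Real.exp 10000 ≤ Real.log N := (Real.le_log_iff_exp_le hN0).2 hNe
  have hlog0 : 0 < Real.log N := (Real.exp_pos _).trans_le hlog
  set Q := (N + 1).primesBelow with hQdef
  have hQ : ∀ p ∈ Q, p.Prime := fun p hp => Nat.prime_of_mem_primesBelow hp
  have hQcard : Q.card ≤ N := by
    have : Q ⊆ Finset.Ioc 0 N := fun p hp => by
      have h1 := Nat.lt_of_mem_primesBelow hp
      have h2 := (hQ p hp).pos
      rw [Finset.mem_Ioc]
      omega
    simpa using Finset.card_le_card this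
  have hLT := log_le_exp_two_mul_recipSum (show 1 ≤ N by omega)
  rw [← hQdef] at hLT
  set T := recipSum Q
  have hT : 5000 ≤ T := by
    have := Real.exp_le_exp.1 (hlog.trans hLT)
    linarith
  have hT0 : 0 < T := by linarith
  set I := Finset.Ioc 0 N with hI
  -- Typical factors have about `T` prime divisors each, so typical products have nearly `2T`. A
  -- typical integer up to `N²` has only about `T`, so such products are rare.
  set H := (I ×ˢ I).filter fun x => x.1 < x.2 ∧ 17 / 10 * T ≤ (divisorCountIn Q (x.1 * x.2) : ℝ)
    with hH
  refine ⟨H, fun e he => ?_, ?_, ?_⟩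
  · obtain ⟨h1, h2, -⟩ := Finset.mem_filter.1 he
    obtain ⟨h1, h3⟩ := Finset.mem_product.1 h1
    exact ⟨(Finset.mem_Ioc.1 h1).1, h2, (Finset.mem_Ioc.1 h3).2⟩
  · set B := I.filter fun a => (divisorCountIn Q a : ℝ) < 9 / 10 * T with hB
    set G := (I ×ˢ I).filter fun x =>
      T / 10 ≤ ((Q.filter fun p => p ∣ x.1 ∧ p ∣ x.2).card : ℝ) with hG
    have hBcard : (B.card : ℝ) ≤ 300 * N / T := card_divisorCountIn_lt_le hQ hQcard hT0
    have hGcard : (G.card : ℝ) ≤ 2 * N ^ 2 / (T / 10) :=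
      card_common_divisorCountIn_le hQ (by linarith)
    have hsub : ((I ×ˢ I).filter fun x => x.1 < x.2) ⊆ H ∪ ((B ×ˢ I) ∪ (I ×ˢ B) ∪ G) := by
      intro x hx
      obtain ⟨hxI, hlt⟩ := Finset.mem_filter.1 hx
      obtain ⟨h1, h2⟩ := Finset.mem_product.1 hxI
      by_contra hcon
      simp only [Finset.mem_union, Finset.mem_product, not_or] at hcon
      obtain ⟨hc1, ⟨hc2, hc3⟩, hc4⟩ := hcon
      have g1 : 9 / 10 * T ≤ divisorCountIn Q x.1 := by
        by_contra! h
        exact hc2 ⟨Finset.mem_filter.2 ⟨h1, h⟩, h2⟩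
      have g2 : 9 / 10 * T ≤ divisorCountIn Q x.2 := by
        by_contra! h
        exact hc3 ⟨h1, Finset.mem_filter.2 ⟨h2, h⟩⟩
      have g3 : ((Q.filter fun p => p ∣ x.1 ∧ p ∣ x.2).card : ℝ) < T / 10 := by
        by_contra! h
        exact hc4 (Finset.mem_filter.2 ⟨hxI, h⟩)
      have g4 : (divisorCountIn Q x.1 : ℝ) + divisorCountIn Q x.2 ≤
          divisorCountIn Q (x.1 * x.2) + (Q.filter fun p => p ∣ x.1 ∧ p ∣ x.2).card := by
        exact_mod_cast divisorCountIn_add_le x.1 x.2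
      exact hc1 (Finset.mem_filter.2 ⟨hxI, hlt, by linarith⟩)
    have hIcard : I.card = N := by simp [hI]
    have hle : ((I ×ˢ I).filter fun x => x.1 < x.2).card ≤
        H.card + (B.card * N + N * B.card + G.card) := by
      refine (Finset.card_le_card hsub).trans ((Finset.card_union_le _ _).trans ?_)
      refine Nat.add_le_add_left ((Finset.card_union_le _ _).trans ?_) _
      refine Nat.add_le_add_right ((Finset.card_union_le _ _).trans ?_) _
      rw [Finset.card_product, Finset.card_product, hIcard]
    have h2 := two_mul_card_filter_lt I
    rw [hIcard] at h2
    have h2' : 2 * (((I ×ˢ I).filter fun x => x.1 < x.2).card : ℝ) + N = N ^ 2 := by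
      exact_mod_cast h2
    have hle' : (((I ×ˢ I).filter fun x => x.1 < x.2).card : ℝ) ≤
        H.card + (B.card * N + N * B.card + G.card) := by exact_mod_cast hle
    have hN2' : (2 : ℝ) ≤ N := by exact_mod_cast hN2
    have b1 : 300 * N / T ≤ N * (3 / 50) := by
      rw [div_le_iff₀ hT0]
      nlinarith
    have b2 : 2 * (N : ℝ) ^ 2 / (T / 10) ≤ N ^ 2 / 250 := by
      rw [div_le_iff₀ (by linarith)]
      have : 0 ≤ (N : ℝ) ^ 2 := by positivity
      nlinarith
    have b3 : (B.card : ℝ) * N ≤ N * (3 / 50) * N :=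
      mul_le_mul_of_nonneg_right (hBcard.trans b1) hN0.le
    nlinarith
  · have hsub : (H.image fun e => e.1 * e.2) ⊆ (Finset.Ioc 0 (N ^ 2)).filter fun x =>
        17 / 10 * recipSum Q ≤ (divisorCountIn Q x : ℝ) := by
      refine Finset.image_subset_iff.2 fun e he => ?_
      obtain ⟨h1, -, h2⟩ := Finset.mem_filter.1 he
      obtain ⟨h1, h3⟩ := Finset.mem_product.1 h1
      rw [Finset.mem_Ioc] at h1 h3
      refine Finset.mem_filter.2 ⟨Finset.mem_Ioc.2 ⟨Nat.mul_pos h1.1 h3.1, ?_⟩, h2⟩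
      rw [sq]
      exact Nat.mul_le_mul h1.2 h3.2
    have h1 : ((H.image fun e => e.1 * e.2).card : ℝ) ≤ _ :=
      (Nat.cast_le.2 (Finset.card_le_card hsub)).trans (card_le_divisorCountIn_le hQ (N ^ 2))
    refine h1.trans ?_
    rw [Real.exp_neg, div_eq_mul_inv]
    push_cast
    refine mul_le_mul_of_nonneg_left (inv_anti₀ (by positivity) ?_) (by positivity)
    rw [← Real.rpow_natCast, ← Real.rpow_mul hlog0.le]
    calc Real.log N ^ (1 / 24 * (2 : ℕ) : ℝ) ≤ Real.exp (2 * T) ^ (1 / 24 * (2 : ℕ) : ℝ) :=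
          Real.rpow_le_rpow hlog0.le hLT (by norm_num)
      _ = Real.exp (T / 6) := by
          rw [← Real.exp_mul]
          congr 1
          push_cast
          ring

/-! ### Sum-products of matchings via sets of disjoint pairs -/

lemma SP_le {R V : Type*} [CommRing R] (G : SimpleGraph V) {A : V → R}
    (hA : Function.Injective A) :
    SP R G ≤ max (graphSumSet G A).ncard (graphProdSet G A).ncard :=
  Nat.sInf_le ⟨A, hA, rfl⟩

/-- The given injection ensures that the infimum is attained rather than being the default value 0
of an empty infimum. -/
lemma exists_SP_eq {V : Type*} (G : SimpleGraph V) {A₀ : V → ℤ} (hA₀ : Function.Injective A₀) :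
    ∃ A : V → ℤ, Function.Injective A ∧
      SP ℤ G = max (graphSumSet G A).ncard (graphProdSet G A).ncard :=
  Nat.sInf_mem (s := {m : ℕ | ∃ A : V → ℤ, Function.Injective A ∧
    m = max (graphSumSet G A).ncard (graphProdSet G A).ncard}) ⟨_, A₀, hA₀, rfl⟩

/-- Matchings exist in all sizes and universes. -/
lemma exists_isMatchingOfSize (n : ℕ) :
    ∃ (V : Type u) (M : SimpleGraph V), IsMatchingOfSize M n := by
  let G : SimpleGraph (ULift.{u} (Fin n × Bool)) :=
    { Adj := fun x y => x.down.1 = y.down.1 ∧ x.down.2 ≠ y.down.2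
      symm := ⟨fun x y h => ⟨h.1.symm, h.2.symm⟩⟩
      loopless := ⟨fun x h => h.2 rfl⟩ }
  refine ⟨_, G, ?_, ?_⟩
  · rintro ⟨i, b⟩ -
    refine ⟨⟨i, !b⟩, ⟨rfl, by simp⟩, ?_⟩
    rintro ⟨j, c⟩ ⟨h1, h2⟩
    simp only at h1 h2
    subst h1
    cases b <;> cases c <;> simp_all
  · let f : Fin n → Sym2 (ULift.{u} (Fin n × Bool)) := fun i => s(⟨(i, false)⟩, ⟨(i, true)⟩)
    have hf : Function.Injective f := by
      intro i j h
      simpa [f] using h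
    have hr : G.edgeSet = Set.range f := by
      ext e
      induction e with | _ x y
      obtain ⟨i, b⟩ := x
      obtain ⟨j, c⟩ := y
      rw [SimpleGraph.mem_edgeSet]
      constructor
      · rintro ⟨h1, h2⟩
        simp only at h1 h2
        subst h1
        refine ⟨i, ?_⟩
        cases b <;> cases c <;> simp_all [f, Sym2.eq_swap]
      · rintro ⟨k, hk⟩
        simp only [f, Sym2.eq_iff, ULift.up.injEq, Prod.mk.injEq] at hk
        rcases hk with ⟨⟨rfl, rfl⟩, rfl, rfl⟩ | ⟨⟨rfl, rfl⟩, rfl, rfl⟩ <;> exact ⟨rfl, by simp⟩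
    rw [hr, ← Set.image_univ, hf.encard_image]
    simp

/-- A matching of integers bounds the sum-product of a matching of the same size. -/
lemma SP_le_of_disjointPairs {V : Type*} {G : SimpleGraph V} {n : ℕ} (hG : IsMatchingOfSize G n)
    {M : Finset (ℤ × ℤ)} (hM : DisjointPairs M) (hn : n ≤ M.card) :
    SP ℤ G ≤ max (pairSums M).card (pairProds M).card := by
  classical
  obtain ⟨hmatch, hcard⟩ := hG
  have hpart : ∀ v, ∃ w, G.Adj v w ∧ ∀ y, G.Adj v y → y = w := by
    intro v
    obtain ⟨w, hw, hu⟩ := hmatch (Set.mem_univ v)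
    exact ⟨w, hw, hu⟩
  choose m hm hmu using hpart
  have hfin : G.edgeSet.Finite := Set.finite_of_encard_eq_coe hcard
  have : Fintype G.edgeSet := hfin.fintype
  obtain ⟨g⟩ : Nonempty (G.edgeSet ↪ M) := by
    refine Function.Embedding.nonempty_of_card_le ?_
    rw [Fintype.card_coe, ← Nat.card_eq_fintype_card, Nat.card_coe_set_eq, Set.ncard, hcard]
    simpa using hn
  let e : V → G.edgeSet := fun v => ⟨s(v, m v), hm v⟩
  -- The choice depends only on the edge, so both endpoints agree on its orientation.
  let o : V → V := fun v => (Quot.out (e v).1).1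
  have ho : ∀ v, o v = v ∨ o v = m v := fun v => by
    have := Sym2.out_fst_mem (e v).1
    simpa [e, o] using this
  let A : V → ℤ := fun v => if o v = v then (g (e v)).1.1 else (g (e v)).1.2
  have he : ∀ u v, G.Adj u v → e u = e v := by
    intro u v h
    have h1 := hmu u v h
    have h2 := hmu v u h.symm
    apply Subtype.ext
    change s(u, m u) = s(v, m v)
    rw [← h1, ← h2, Sym2.eq_swap]
  have hA' : ∀ u v, G.Adj u v → (A u = (g (e u)).1.1 ∧ A v = (g (e u)).1.2) ∨
      (A u = (g (e u)).1.2 ∧ A v = (g (e u)).1.1) := by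
    intro u v h
    have h1 := he u v h
    have h2 : o u = o v := by simp only [o, h1]
    have h3 := hmu u v h
    rcases ho u with h4 | h4
    · refine Or.inl ⟨if_pos h4, ?_⟩
      rw [h1]
      exact if_neg fun h5 => h.ne (by rw [← h4, h2, h5])
    · refine Or.inr ⟨if_neg fun h5 => h.ne (by rw [h3, ← h4, h5]), ?_⟩
      rw [h1]
      exact if_pos (by rw [← h2, h4, h3])
  have hmem : ∀ v, A v = (g (e v)).1.1 ∨ A v = (g (e v)).1.2 := fun v => by
    by_cases h : o v = v
    · exact Or.inl (if_pos h)
    · exact Or.inr (if_neg h)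
  have hAinj : Function.Injective A := by
    intro u v huv
    have hguv : g (e u) = g (e v) := by
      by_contra hne
      obtain ⟨h1, h2, h3, h4⟩ := hM.2 _ (g (e u)).2 _ (g (e v)).2 fun h => hne (Subtype.ext h)
      rcases hmem u with h5 | h5 <;> rcases hmem v with h6 | h6 <;> rw [h5, h6] at huv <;>
        contradiction
    have heuv := congrArg Subtype.val (g.injective hguv)
    rcases Sym2.eq_iff.1 heuv with ⟨h, -⟩ | ⟨-, h⟩
    · exact h
    · exfalso
      have hadj : G.Adj u v := h ▸ hm u
      have hne := hM.1 _ (g (e u)).2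
      rcases hA' u v hadj with ⟨h5, h6⟩ | ⟨h5, h6⟩ <;> rw [h5, h6] at huv
      · exact hne huv
      · exact hne huv.symm
  refine (SP_le G hAinj).trans (max_le_max ?_ ?_)
  · rw [← Set.ncard_coe_finset]
    refine Set.ncard_le_ncard ?_ (Finset.finite_toSet _)
    rintro x ⟨u, v, h, rfl⟩
    refine Finset.mem_coe.2 (Finset.mem_image.2 ⟨(g (e u)).1, (g (e u)).2, ?_⟩)
    rcases hA' u v h with ⟨h1, h2⟩ | ⟨h1, h2⟩ <;> rw [h1, h2]
    exact add_comm _ _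
  · rw [← Set.ncard_coe_finset]
    refine Set.ncard_le_ncard ?_ (Finset.finite_toSet _)
    rintro x ⟨u, v, h, rfl⟩
    refine Finset.mem_coe.2 (Finset.mem_image.2 ⟨(g (e u)).1, (g (e u)).2, ?_⟩)
    rcases hA' u v h with ⟨h1, h2⟩ | ⟨h1, h2⟩ <;> rw [h1, h2]
    exact mul_comm _ _

/-- For `0 < |a| < L`, the size of `L^i a` lies in `[L^i, L^(i+1))`, and these ranges are disjoint.
Hence dilates by different powers of `L` share no entries. -/
lemma pow_mul_eq_pow_mul {L : ℕ} {a b : ℤ} (ha : a ≠ 0) (hb : b ≠ 0) (haL : a.natAbs < L)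
    (hbL : b.natAbs < L) {i j : ℕ} (h : (L : ℤ) ^ i * a = (L : ℤ) ^ j * b) : i = j ∧ a = b := by
  have hL : 0 < L := by omega
  have key : ∀ {a b : ℤ} {i j : ℕ}, b ≠ 0 → a.natAbs < L →
      (L : ℤ) ^ i * a = (L : ℤ) ^ j * b → j ≤ i := by
    intro a b i j hb haL h
    by_contra! hij
    have h1 := congrArg Int.natAbs h
    simp only [Int.natAbs_mul, Int.natAbs_pow, Int.natAbs_natCast] at h1
    have h2 : L ^ i * a.natAbs < L ^ i * L := Nat.mul_lt_mul_of_pos_left haL (pow_pos hL i)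
    have h3 : L ^ i * L ≤ L ^ j := by
      rw [← pow_succ]
      exact Nat.pow_le_pow_right hL hij
    have h4 : L ^ j ≤ L ^ j * b.natAbs := Nat.le_mul_of_pos_right _ (Int.natAbs_pos.2 hb)
    omega
  have hij : i = j := le_antisymm (key ha hbL h.symm) (key hb haL h)
  subst hij
  have hLi : (L : ℤ) ^ i ≠ 0 := pow_ne_zero _ (by exact_mod_cast hL.ne')
  exact ⟨rfl, mul_left_cancel₀ hLi h⟩

/-- Disjoint dilates of a matching of nonzero integers. -/
lemma exists_dilated_disjointPairs {M : Finset (ℤ × ℤ)} (hM : DisjointPairs M)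
    (h0 : ∀ e ∈ M, e.1 ≠ 0 ∧ e.2 ≠ 0) (r : ℕ) :
    ∃ M' : Finset (ℤ × ℤ), DisjointPairs M' ∧ M'.card = r * M.card ∧
      (pairSums M').card ≤ r * (pairSums M).card ∧
      (pairProds M').card ≤ r * (pairProds M).card := by
  obtain ⟨L, hL⟩ : ∃ L : ℕ, ∀ e ∈ M, e.1.natAbs < L ∧ e.2.natAbs < L := by
    refine ⟨M.sup (fun e => max e.1.natAbs e.2.natAbs) + 1, fun e he => ?_⟩
    have := Finset.le_sup (f := fun e : ℤ × ℤ => max e.1.natAbs e.2.natAbs) he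
    omega
  let φ : ℕ × (ℤ × ℤ) → ℤ × ℤ := fun x => ((L : ℤ) ^ x.1 * x.2.1, (L : ℤ) ^ x.1 * x.2.2)
  refine ⟨(Finset.range r ×ˢ M).image φ, ⟨?_, ?_⟩, ?_, ?_, ?_⟩
  · intro e he
    obtain ⟨⟨i, e⟩, hx, rfl⟩ := Finset.mem_image.1 he
    have hx := (Finset.mem_product.1 hx).2
    intro h
    exact hM.1 e hx (pow_mul_eq_pow_mul (h0 e hx).1 (h0 e hx).2 (hL e hx).1 (hL e hx).2 h).2
  · intro e he f hf hef
    obtain ⟨⟨i, e⟩, hx, rfl⟩ := Finset.mem_image.1 he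
    obtain ⟨⟨j, f⟩, hy, rfl⟩ := Finset.mem_image.1 hf
    replace hx := (Finset.mem_product.1 hx).2
    replace hy := (Finset.mem_product.1 hy).2
    simp only at hx hy
    have hd : i = j → e ≠ f := by
      rintro rfl rfl
      exact hef rfl
    refine ⟨fun h => ?_, fun h => ?_, fun h => ?_, fun h => ?_⟩
    · have h' := pow_mul_eq_pow_mul (h0 e hx).1 (h0 f hy).1 (hL e hx).1 (hL f hy).1 h
      exact (hM.2 e hx f hy (hd h'.1)).1 h'.2
    · have h' := pow_mul_eq_pow_mul (h0 e hx).1 (h0 f hy).2 (hL e hx).1 (hL f hy).2 h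
      exact (hM.2 e hx f hy (hd h'.1)).2.1 h'.2
    · have h' := pow_mul_eq_pow_mul (h0 e hx).2 (h0 f hy).1 (hL e hx).2 (hL f hy).1 h
      exact (hM.2 e hx f hy (hd h'.1)).2.2.1 h'.2
    · have h' := pow_mul_eq_pow_mul (h0 e hx).2 (h0 f hy).2 (hL e hx).2 (hL f hy).2 h
      exact (hM.2 e hx f hy (hd h'.1)).2.2.2 h'.2
  · rw [Finset.card_image_of_injOn, Finset.card_product, Finset.card_range]
    rintro ⟨i, e⟩ hx ⟨j, f⟩ hy h
    replace hx := (Finset.mem_product.1 hx).2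
    replace hy := (Finset.mem_product.1 hy).2
    simp only at hx hy
    have h1 := pow_mul_eq_pow_mul (h0 e hx).1 (h0 f hy).1 (hL e hx).1 (hL f hy).1
      (congrArg Prod.fst h)
    have h2 := pow_mul_eq_pow_mul (h0 e hx).2 (h0 f hy).2 (hL e hx).2 (hL f hy).2
      (congrArg Prod.snd h)
    exact Prod.ext h1.1 (Prod.ext h1.2 h2.2)
  · have hsub : pairSums ((Finset.range r ×ˢ M).image φ) ⊆
        (Finset.range r ×ˢ pairSums M).image fun x => (L : ℤ) ^ x.1 * x.2 := by
      intro x hx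
      simp only [pairSums, Finset.mem_image] at hx
      obtain ⟨_, ⟨⟨i, e⟩, hx, rfl⟩, rfl⟩ := hx
      obtain ⟨hi, he⟩ := Finset.mem_product.1 hx
      exact Finset.mem_image.2 ⟨(i, e.1 + e.2), Finset.mem_product.2
        ⟨hi, Finset.mem_image_of_mem _ he⟩, mul_add _ _ _⟩
    refine (Finset.card_le_card hsub).trans (Finset.card_image_le.trans ?_)
    rw [Finset.card_product, Finset.card_range]
  · have hsub : pairProds ((Finset.range r ×ˢ M).image φ) ⊆
        (Finset.range r ×ˢ pairProds M).image fun x => ((L : ℤ) ^ x.1 * (L : ℤ) ^ x.1) * x.2 := by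
      intro x hx
      simp only [pairProds, Finset.mem_image] at hx
      obtain ⟨_, ⟨⟨i, e⟩, hx, rfl⟩, rfl⟩ := hx
      obtain ⟨hi, he⟩ := Finset.mem_product.1 hx
      exact Finset.mem_image.2 ⟨(i, e.1 * e.2), Finset.mem_product.2
        ⟨hi, Finset.mem_image_of_mem _ he⟩, (mul_mul_mul_comm _ _ _ _).symm⟩
    refine (Finset.card_le_card hsub).trans (Finset.card_image_le.trans ?_)
    rw [Finset.card_product, Finset.card_range]

/-! ### Trivial bounds and a saving of one -/

/-- The matching `{10, 11}, {12, 13}, …` with `k` edges. -/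
def consecutivePairs (k : ℕ) : Finset (ℤ × ℤ) :=
  (Finset.range k).image fun i : ℕ => (10 + 2 * (i : ℤ), 11 + 2 * (i : ℤ))

lemma card_consecutivePairs (k : ℕ) : (consecutivePairs k).card = k := by
  rw [consecutivePairs, Finset.card_image_of_injective, Finset.card_range]
  intro i j h
  simp only [Prod.mk.injEq] at h
  omega

lemma disjointPairs_consecutivePairs (k : ℕ) : DisjointPairs (consecutivePairs k) := by
  constructor
  · intro e he
    obtain ⟨i, -, rfl⟩ := Finset.mem_image.1 he
    simp
  · intro e he f hf hef
    obtain ⟨i, -, rfl⟩ := Finset.mem_image.1 he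
    obtain ⟨j, -, rfl⟩ := Finset.mem_image.1 hf
    have : i ≠ j := fun h => hef (by rw [h])
    simp only
    omega

lemma SP_le_size {V : Type*} {G : SimpleGraph V} {n : ℕ} (hG : IsMatchingOfSize G n) :
    SP ℤ G ≤ n := by
  refine (SP_le_of_disjointPairs hG (disjointPairs_consecutivePairs n)
    (card_consecutivePairs n).ge).trans (max_le ?_ ?_) <;>
  exact Finset.card_image_le.trans (card_consecutivePairs n).le

/-- The matching `{2, 6}, {3, 4}, {1, 7}` has two sums and two products. -/
lemma SP_add_one_le_size {V : Type*} {G : SimpleGraph V} {n : ℕ} (hG : IsMatchingOfSize G n)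
    (hn : 3 ≤ n) : SP ℤ G + 1 ≤ n := by
  set B : Finset (ℤ × ℤ) := {(2, 6), (3, 4), (1, 7)} with hB
  -- Starting the consecutive pairs at 10 keeps them disjoint from the three special pairs.
  have hlarge : ∀ e ∈ consecutivePairs (n - 3), 10 ≤ e.1 ∧ 10 ≤ e.2 := by
    intro e he
    obtain ⟨i, -, rfl⟩ := Finset.mem_image.1 he
    simp only
    omega
  have hsmall : ∀ e ∈ B, e.1 < 10 ∧ e.2 < 10 := by decide
  have hBd : DisjointPairs B := by
    constructor <;> decide
  have hd : DisjointPairs (B ∪ consecutivePairs (n - 3)) := by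
    have hC := disjointPairs_consecutivePairs (n - 3)
    constructor
    · intro e he
      exact (Finset.mem_union.1 he).elim (hBd.1 e) (hC.1 e)
    · intro e he f hf hef
      rcases Finset.mem_union.1 he with he | he <;> rcases Finset.mem_union.1 hf with hf | hf
      · exact hBd.2 e he f hf hef
      · have h1 := hsmall e he
        have h2 := hlarge f hf
        omega
      · have h1 := hlarge e he
        have h2 := hsmall f hf
        omega
      · exact hC.2 e he f hf hef
  have hdisj : Disjoint B (consecutivePairs (n - 3)) := by
    rw [Finset.disjoint_left]
    intro e he hf
    have h1 := hsmall e he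
    have h2 := hlarge e hf
    omega
  have hcard : n ≤ (B ∪ consecutivePairs (n - 3)).card := by
    rw [Finset.card_union_of_disjoint hdisj, card_consecutivePairs]
    have : B.card = 3 := by decide
    omega
  have hle := SP_le_of_disjointPairs hG hd hcard
  have hs : (pairSums (B ∪ consecutivePairs (n - 3))).card ≤ 2 + (n - 3) := by
    rw [pairSums, Finset.image_union]
    refine (Finset.card_union_le _ _).trans (Nat.add_le_add (by decide) ?_)
    exact Finset.card_image_le.trans (card_consecutivePairs _).le
  have hp : (pairProds (B ∪ consecutivePairs (n - 3))).card ≤ 2 + (n - 3) := by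
    rw [pairProds, Finset.image_union]
    refine (Finset.card_union_le _ _).trans (Nat.add_le_add (by decide) ?_)
    exact Finset.card_image_le.trans (card_consecutivePairs _).le
  have := max_le hs hp
  omega

/-! ### Comparison with the complete graph -/

lemma one_le_SP_top {n : ℕ} (hn : 2 ≤ n) : 1 ≤ SP ℤ (⊤ : SimpleGraph (Fin n)) := by
  obtain ⟨A, -, h⟩ := exists_SP_eq (⊤ : SimpleGraph (Fin n))
    (A₀ := fun i => ((i : ℕ) : ℤ)) fun i j h => Fin.ext (by simpa using h)
  rw [h]
  have hfin : (graphSumSet (⊤ : SimpleGraph (Fin n)) A).Finite := by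
    refine (Set.finite_range fun x : Fin n × Fin n => A x.1 + A x.2).subset ?_
    rintro _ ⟨u, v, -, rfl⟩
    exact ⟨(u, v), rfl⟩
  exact le_max_of_le_left ((Set.ncard_pos hfin).2
    ⟨_, ⟨0, by omega⟩, ⟨1, by omega⟩, by simp, rfl⟩)

/-- A set of nonzero integers achieving the sum-product of the complete graph, up to removing
zero. -/
lemma exists_finset_of_SP_top {n : ℕ} :
    ∃ (A : Finset ℤ) (H : Finset (ℤ × ℤ)), (0 : ℤ) ∉ A ∧ A.card ≤ n ∧ n ≤ A.card + 1 ∧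
      (∀ e ∈ H, e.1 ∈ A ∧ e.2 ∈ A ∧ e.1 < e.2) ∧ 2 * H.card + A.card = A.card ^ 2 ∧
      (pairSums H).card ≤ SP ℤ (⊤ : SimpleGraph (Fin n)) ∧
      (pairProds H).card ≤ SP ℤ (⊤ : SimpleGraph (Fin n)) := by
  obtain ⟨A, hA, h⟩ := exists_SP_eq (⊤ : SimpleGraph (Fin n))
    (A₀ := fun i => ((i : ℕ) : ℤ)) fun i j h => Fin.ext (by simpa using h)
  set I := Finset.univ.image A with hI
  have hIcard : I.card = n := by
    rw [hI, Finset.card_image_of_injective _ hA, Finset.card_univ, Fintype.card_fin]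
  have hedge : ∀ e ∈ ((I.erase 0) ×ˢ (I.erase 0)).filter fun x => x.1 < x.2,
      ∃ u v, (⊤ : SimpleGraph (Fin n)).Adj u v ∧ e.1 = A u ∧ e.2 = A v := by
    intro e he
    obtain ⟨he, hlt⟩ := Finset.mem_filter.1 he
    obtain ⟨h1, h2⟩ := Finset.mem_product.1 he
    obtain ⟨u, -, hu⟩ := Finset.mem_image.1 (Finset.mem_of_mem_erase h1)
    obtain ⟨v, -, hv⟩ := Finset.mem_image.1 (Finset.mem_of_mem_erase h2)
    refine ⟨u, v, ?_, hu.symm, hv.symm⟩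
    rintro rfl
    omega
  refine ⟨I.erase 0, ((I.erase 0) ×ˢ (I.erase 0)).filter fun x => x.1 < x.2,
    Finset.notMem_erase _ _, hIcard ▸ Finset.card_erase_le, ?_, ?_,
    two_mul_card_filter_lt _, ?_, ?_⟩
  · have := Finset.pred_card_le_card_erase (s := I) (a := 0)
    omega
  · intro e he
    obtain ⟨he, hlt⟩ := Finset.mem_filter.1 he
    exact ⟨(Finset.mem_product.1 he).1, (Finset.mem_product.1 he).2, hlt⟩
  · rw [h, ← Set.ncard_coe_finset]
    refine le_max_of_le_left (Set.ncard_le_ncard ?_ ?_)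
    · intro x hx
      obtain ⟨e, he, rfl⟩ := Finset.mem_image.1 (Finset.mem_coe.1 hx)
      obtain ⟨u, v, huv, h1, h2⟩ := hedge e he
      exact ⟨u, v, huv, by rw [h1, h2]⟩
    · refine (Set.finite_range fun x : Fin n × Fin n => A x.1 + A x.2).subset ?_
      rintro _ ⟨u, v, -, rfl⟩
      exact ⟨(u, v), rfl⟩
  · rw [h, ← Set.ncard_coe_finset]
    refine le_max_of_le_right (Set.ncard_le_ncard ?_ ?_)
    · intro x hx
      obtain ⟨e, he, rfl⟩ := Finset.mem_image.1 (Finset.mem_coe.1 hx)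
      obtain ⟨u, v, huv, h1, h2⟩ := hedge e he
      exact ⟨u, v, huv, by rw [h1, h2]⟩
    · refine (Set.finite_range fun x : Fin n × Fin n => A x.1 * A x.2).subset ?_
      rintro _ ⟨u, v, -, rfl⟩
      exact ⟨(u, v), rfl⟩

/-- The sum-product of a matching is smaller than that of a complete graph by a factor of the
square root of the size. -/
lemma SP_matching_le_SP_top {V : Type*} {G : SimpleGraph V} {n : ℕ} (hn : 2 ≤ n)
    (hG : IsMatchingOfSize G n) :
    (SP ℤ G : ℝ) ≤ 40000 * ((SP ℤ (⊤ : SimpleGraph (Fin n)) : ℝ) / Real.sqrt n) := by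
  have hn0 : (0 : ℝ) < n := by positivity
  have hsq0 : 0 < Real.sqrt n := Real.sqrt_pos.2 hn0
  have hsq : Real.sqrt n * Real.sqrt n = n := Real.mul_self_sqrt hn0.le
  have hm1 : (1 : ℝ) ≤ SP ℤ (⊤ : SimpleGraph (Fin n)) := by exact_mod_cast one_le_SP_top hn
  rw [← mul_div_assoc, le_div_iff₀ hsq0]
  rcases lt_or_ge n 4 with hn4 | hn4
  · have h1 : (SP ℤ G : ℝ) ≤ 3 := by
      have := SP_le_size hG
      have : SP ℤ G ≤ 3 := by omega
      exact_mod_cast this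
    have h2 : Real.sqrt n ≤ 2 := by
      rw [Real.sqrt_le_left (by norm_num)]
      have : (n : ℝ) ≤ 4 := by exact_mod_cast hn4.le
      linarith
    nlinarith [Nat.cast_nonneg (α := ℝ) (SP ℤ G)]
  obtain ⟨A, H, hA0, hAn, hnA, hH, hHcard, hS, hP⟩ := exists_finset_of_SP_top (n := n)
  set m := SP ℤ (⊤ : SimpleGraph (Fin n))
  -- From `|A| ≥ n - 1` one gets `|H| ≥ (n-1)(n-2)/2`, which is at least `n²/6` once `n ≥ 4`; this
  -- is why smaller `n` are treated apart.
  have hHn : 6 * H.card ≥ n ^ 2 := by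
    have h3 : A.card * A.card = 2 * H.card + A.card := by rw [hHcard, sq]
    nlinarith
  have hHn' : (n : ℝ) ^ 2 ≤ 6 * H.card := by exact_mod_cast hHn
  have hAn' : (A.card : ℝ) ≤ n := by exact_mod_cast hAn
  have hS' : ((pairSums H).card : ℝ) ≤ m := by exact_mod_cast hS
  have hP' : ((pairProds H).card : ℝ) ≤ m := by exact_mod_cast hP
  set w := Real.sqrt n
  have hw1 : 1 ≤ 3 * w := by
    have : (1 : ℝ) ≤ n := by exact_mod_cast (by omega : 1 ≤ n)
    nlinarith
  -- Here `8|A|pq ≤ 8/9`.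
  obtain ⟨M, hMH, hMd, h1, h2, h3⟩ := exists_disjointPairs A hA0 H hH (p := (3 * w)⁻¹)
    (q := (3 * w)⁻¹) (by positivity) (inv_le_one_of_one_le₀ hw1) (by positivity)
    (inv_le_one_of_one_le₀ hw1) (by
      rw [← mul_inv, ← div_eq_mul_inv, div_le_one (by positivity)]
      nlinarith)
  have key : ∀ x y : ℝ, x * (H.card * (3 * w)⁻¹) ≤ 8 * A.card * y → 0 ≤ x → y ≤ m →
      x * w ≤ 144 * m := by
    intro x y hxy hx hy
    rw [← mul_assoc, ← div_eq_mul_inv, div_le_iff₀ (by positivity)] at hxy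
    have e1 : x * n ^ 2 ≤ x * (6 * H.card) := mul_le_mul_of_nonneg_left hHn' hx
    have e2 : 8 * (A.card : ℝ) * y * (3 * w) ≤ 8 * n * m * (3 * w) := by
      have : (A.card : ℝ) * y ≤ n * m := by
        calc (A.card : ℝ) * y ≤ A.card * m := by gcongr
          _ ≤ n * m := by gcongr
      nlinarith
    have e3 : (x * w) * (n * w) ≤ (144 * m) * (n * w) := by
      calc (x * w) * (n * w) = x * n * (w * w) := by ring
        _ = x * n ^ 2 := by rw [hsq]; ring
        _ ≤ (144 * m) * (n * w) := by linarith
    exact le_of_mul_le_mul_right e3 (by positivity)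
  have hs := key _ _ h2 (Nat.cast_nonneg _) hS'
  have hp := key _ _ h3 (Nat.cast_nonneg _) hP'
  -- The constant is `216 = 6 · 4 · 9`, so 216 dilates suffice. The final factor is `216 · 144 =
  -- 31104`, below 40000.
  have hMn : n ≤ 216 * M.card := by
    rw [← mul_inv, ← div_eq_mul_inv, div_le_iff₀ (by positivity)] at h1
    have e1 : (n : ℝ) * n ≤ (216 * M.card) * n := by
      calc (n : ℝ) * n ≤ 6 * H.card := by linarith
        _ ≤ 6 * (4 * M.card * (3 * w * (3 * w))) := by linarith
        _ = 216 * M.card * (w * w) := by ring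
        _ = _ := by rw [hsq]
    have := le_of_mul_le_mul_right e1 hn0
    exact_mod_cast this
  obtain ⟨M', hM'd, hM'card, hM'S, hM'P⟩ := exists_dilated_disjointPairs hMd (fun e he =>
    ⟨fun h => hA0 (h ▸ (hH e (hMH he)).1), fun h => hA0 (h ▸ (hH e (hMH he)).2.1)⟩) 216
  have hle := SP_le_of_disjointPairs hG hM'd (hMn.trans hM'card.ge)
  rcases le_max_iff.1 hle with hle | hle
  · have : (SP ℤ G : ℝ) ≤ 216 * (pairSums M).card := by exact_mod_cast hle.trans hM'S
    nlinarith
  · have : (SP ℤ G : ℝ) ≤ 216 * (pairProds M).card := by exact_mod_cast hle.trans hM'P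
    nlinarith

/-! ### The logarithmic saving -/

/-- Large matchings have sum-product smaller than their size by a power of the logarithm. -/
lemma exists_SP_matching_le_div_log_of_large :
    ∃ N₁ : ℕ, ∀ n : ℕ, N₁ ≤ n → ∀ (V : Type u) (G : SimpleGraph V), IsMatchingOfSize G n →
      (SP ℤ G : ℝ) ≤ n / Real.log n ^ (1 / 48 : ℝ) := by
  obtain ⟨N₀, hN₀⟩ := exists_dense_graph_few_products
  have ht : Filter.Tendsto (fun n : ℕ => Real.log n ^ (1 / 48 : ℝ)) Filter.atTop Filter.atTop :=
    (tendsto_rpow_atTop (by norm_num)).comp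
      (Real.tendsto_log_atTop.comp tendsto_natCast_atTop_atTop)
  -- The bound obtained below is `1024 N / L = 262144 n / L`. Halving the exponent from `1/24` to
  -- `1/48` leaves a spare factor to absorb this constant.
  obtain ⟨N₁, hN₁⟩ := Filter.eventually_atTop.1 (ht.eventually_ge_atTop 262144)
  refine ⟨max (max N₀ 3) N₁, fun n hn V G hG => ?_⟩
  have hn3 : 3 ≤ n := (le_max_right _ _).trans ((le_max_left _ _).trans hn)
  have hbig := hN₁ n ((le_max_right _ _).trans hn)
  -- With `|H| ≥ N²/8` and `pq = 1/(8N)`, the matching has at least `N/256 = n` edges, so no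
  -- dilation is needed.
  obtain ⟨H, hH, hHcard, hHP⟩ := hN₀ (256 * n) (by
    have := (le_max_left _ _).trans ((le_max_left _ _).trans hn)
    omega)
  have hn3' : (3 : ℝ) ≤ n := by exact_mod_cast hn3
  set N := 256 * n with hN
  have hNn : (N : ℝ) = 256 * n := by rw [hN]; push_cast; ring
  have hlogn : 1 ≤ Real.log n := by
    rw [Real.le_log_iff_exp_le (by linarith)]
    linarith [Real.exp_one_lt_three]
  have hlogN : Real.log n ≤ Real.log N := Real.log_le_log (by linarith) (by linarith)
  have hN0 : (0 : ℝ) < N := by linarith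
  set L := Real.log N ^ (1 / 24 : ℝ) with hL
  have hL1 : 1 ≤ L := Real.one_le_rpow (hlogn.trans hlogN) (by norm_num)
  have hLN : L ≤ N := by
    calc L ≤ Real.log N ^ (1 : ℝ) :=
          Real.rpow_le_rpow_of_exponent_le (hlogn.trans hlogN) (by norm_num)
      _ = Real.log N := Real.rpow_one _
      _ ≤ N := Real.log_le_self hN0.le
  set l := Real.log n ^ (1 / 48 : ℝ) with hl
  have hl0 : 0 < l := by linarith
  have hlL : l * l ≤ L := by
    rw [hl, hL, ← Real.rpow_add (by linarith)]
    norm_num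
    exact Real.rpow_le_rpow (by linarith) hlogN (by norm_num)
  let c : ℕ × ℕ → ℤ × ℤ := fun e => (e.1, e.2)
  have hc : Function.Injective c := by
    rintro ⟨a, b⟩ ⟨a', b'⟩ h
    simpa [c] using h
  have hcard' : (H.image c).card = H.card := Finset.card_image_of_injective _ hc
  have hAcard : (Finset.Ioc (0 : ℤ) N).card = N := by simp
  obtain ⟨M, -, hMd, h1, h2, h3⟩ := exists_disjointPairs (Finset.Ioc (0 : ℤ) N) (by simp)
    (H.image c) (by
      intro e he
      obtain ⟨x, hx, rfl⟩ := Finset.mem_image.1 he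
      have := hH x hx
      simp only [c, Finset.mem_Ioc]
      omega) (p := L⁻¹) (q := L / (8 * N)) (by positivity) (inv_le_one_of_one_le₀ hL1)
      (by positivity) ((div_le_one (by positivity)).2 (by linarith)) (by
        rw [hAcard]
        field_simp
        exact le_rfl)
  rw [hAcard, hcard'] at h2 h3
  rw [hcard'] at h1
  have hSum : ((pairSums (H.image c)).card : ℝ) ≤ 2 * N := by
    have hsub : pairSums (H.image c) ⊆ Finset.Ioc (0 : ℤ) (2 * N) := by
      intro x hx
      simp only [pairSums, Finset.mem_image] at hx
      obtain ⟨_, ⟨e, he, rfl⟩, rfl⟩ := hx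
      have := hH e he
      simp only [c, Finset.mem_Ioc]
      omega
    have := Finset.card_le_card hsub
    simp only [Int.card_Ioc] at this
    have : (pairSums (H.image c)).card ≤ 2 * N := by omega
    exact_mod_cast this
  have hProd : ((pairProds (H.image c)).card : ℝ) ≤ N ^ 2 / L ^ 2 := by
    refine le_trans (Nat.cast_le.2 ?_) hHP
    have hsub : pairProds (H.image c) ⊆
        (H.image fun e => e.1 * e.2).image fun x : ℕ => (x : ℤ) := by
      intro x hx
      simp only [pairProds, Finset.mem_image] at hx
      obtain ⟨_, ⟨e, he, rfl⟩, rfl⟩ := hx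
      exact Finset.mem_image.2 ⟨e.1 * e.2, Finset.mem_image_of_mem _ he, by simp [c]⟩
    exact (Finset.card_le_card hsub).trans Finset.card_image_le
  have hL0 : 0 < L := by linarith
  have hMn : n ≤ M.card := by
    have e0 : L⁻¹ * (L / (8 * N)) = 1 / (8 * N) := by field_simp
    rw [e0, mul_one_div, div_le_iff₀ (by positivity)] at h1
    have e1 : (n : ℝ) * (32 * N) ≤ M.card * (32 * N) := by
      have : (N : ℝ) ^ 2 = 256 * n * N := by rw [sq, hNn]
      linarith
    have := le_of_mul_le_mul_right e1 (by positivity)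
    exact_mod_cast this
  have hs : ((pairSums M).card : ℝ) * L ≤ 1024 * N := by
    have e1 : ((pairSums M).card : ℝ) * (N ^ 2 / 8 * (L / (8 * N))) ≤ 8 * N * (2 * N) := by
      refine le_trans ?_ (h2.trans (by gcongr))
      gcongr
    have e2 : ((pairSums M).card : ℝ) * (N ^ 2 / 8 * (L / (8 * N))) =
        (pairSums M).card * L * (N / 64) := by field_simp; ring
    rw [e2] at e1
    have e3 : ((pairSums M).card : ℝ) * L * (N / 64) ≤ 1024 * N * (N / 64) := by linarith
    exact le_of_mul_le_mul_right e3 (by positivity)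
  have hp : ((pairProds M).card : ℝ) * L ≤ 1024 * N := by
    have e1 : ((pairProds M).card : ℝ) * (N ^ 2 / 8 * L⁻¹) ≤ 8 * N * (N ^ 2 / L ^ 2) := by
      refine le_trans ?_ (h3.trans (by gcongr))
      gcongr
    have e2 : ((pairProds M).card : ℝ) * (N ^ 2 / 8 * L⁻¹) =
        (pairProds M).card * L * (N ^ 2 / 8 / L ^ 2) := by field_simp
    have e3 : 8 * N * (N ^ 2 / L ^ 2) = 64 * N * (N ^ 2 / 8 / L ^ 2) := by ring
    rw [e2, e3] at e1
    have := le_of_mul_le_mul_right e1 (by positivity)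
    linarith
  have hle := SP_le_of_disjointPairs hG hMd hMn
  have hSP : (SP ℤ G : ℝ) * L ≤ 1024 * N := by
    rcases le_max_iff.1 hle with hle | hle
    · have : (SP ℤ G : ℝ) ≤ (pairSums M).card := by exact_mod_cast hle
      exact (mul_le_mul_of_nonneg_right this hL0.le).trans hs
    · have : (SP ℤ G : ℝ) ≤ (pairProds M).card := by exact_mod_cast hle
      exact (mul_le_mul_of_nonneg_right this hL0.le).trans hp
  rw [le_div_iff₀ hl0]
  have e1 : (SP ℤ G : ℝ) * l * l ≤ n * l := by
    calc (SP ℤ G : ℝ) * l * l = SP ℤ G * (l * l) := by ring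
      _ ≤ SP ℤ G * L := by gcongr
      _ ≤ 1024 * N := hSP
      _ = n * 262144 := by rw [hNn]; ring
      _ ≤ n * l := by gcongr
  exact le_of_mul_le_mul_right e1 hl0

/-- Constants cannot be absorbed for small `n`, where a genuine saving is needed as soon as `log n >
1`, that is, for `n ≥ 3`. Saving one edge suffices if `ε` is tiny; for `n = 2` the trivial bound
works because `log 2 < 1`. -/
lemma exists_SP_matching_le_div_log :
    ∃ ε : ℝ, 0 < ε ∧ ∀ n : ℕ, 2 ≤ n → ∀ (V : Type u) (M : SimpleGraph V),
      IsMatchingOfSize M n → (SP ℤ M : ℝ) ≤ (n : ℝ) / (Real.log n) ^ ε := by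
  obtain ⟨N₁, hN₁⟩ := exists_SP_matching_le_div_log_of_large.{u}
  obtain ⟨N, hN⟩ : ∃ N, N = max N₁ 3 := ⟨_, rfl⟩
  have hN3 : (3 : ℝ) ≤ N := by exact_mod_cast hN ▸ le_max_right N₁ 3
  -- The term `1/N²` gives `(log n)^ε ≤ exp(1/N)` for `3 ≤ n ≤ N`, and `(N - 1) exp(1/N) ≤ N`.
  have hε : 0 < min (1 / 48 : ℝ) (1 / (N : ℝ) ^ 2) := lt_min (by norm_num) (by positivity)
  refine ⟨min (1 / 48) (1 / (N : ℝ) ^ 2), hε, fun n hn V M hM => ?_⟩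
  set ε := min (1 / 48 : ℝ) (1 / (N : ℝ) ^ 2)
  have hn2 : (2 : ℝ) ≤ n := by exact_mod_cast hn
  have hlog0 : 0 < Real.log n := Real.log_pos (by linarith)
  have hpow : 0 < Real.log n ^ ε := Real.rpow_pos_of_pos hlog0 _
  rcases hn.eq_or_lt with rfl | hn3
  · rw [le_div_iff₀ hpow]
    have h1 : Real.log ((2 : ℕ) : ℝ) ^ ε ≤ 1 := by
      refine Real.rpow_le_one hlog0.le ?_ hε.le
      push_cast
      linarith [Real.log_two_lt_d9]
    have h2 : (SP ℤ M : ℝ) ≤ (2 : ℕ) := by exact_mod_cast SP_le_size hM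
    calc (SP ℤ M : ℝ) * Real.log ((2 : ℕ) : ℝ) ^ ε ≤ (2 : ℕ) * 1 := by gcongr
      _ = (2 : ℕ) := mul_one _
  have hn3' : (3 : ℝ) ≤ n := by exact_mod_cast hn3
  have hlog1 : 1 ≤ Real.log n := by
    rw [Real.le_log_iff_exp_le (by linarith)]
    linarith [Real.exp_one_lt_three]
  rcases le_total N n with hNn | hnN
  · refine (hN₁ n (le_trans (hN ▸ le_max_left _ _) hNn) V M hM).trans ?_
    gcongr
    exact min_le_left _ _
  · have hnN' : (n : ℝ) ≤ N := by exact_mod_cast hnN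
    have h1 : (SP ℤ M : ℝ) ≤ n - 1 := by
      have : (SP ℤ M : ℝ) + 1 ≤ n := by exact_mod_cast SP_add_one_le_size hM hn3
      linarith
    have h2 : Real.log n ^ ε ≤ Real.exp (1 / N) := by
      rw [Real.rpow_def_of_pos hlog0]
      refine Real.exp_le_exp.2 ?_
      have e1 : Real.log (Real.log n) ≤ N := by
        have := Real.log_le_self hlog0.le
        have := Real.log_le_self (by linarith : (0 : ℝ) ≤ n)
        linarith
      have e2 : ε ≤ 1 / (N : ℝ) ^ 2 := min_le_right _ _
      calc Real.log (Real.log n) * ε ≤ N * (1 / (N : ℝ) ^ 2) := by gcongr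
        _ = 1 / N := by field_simp
    rw [le_div_iff₀ hpow]
    have h3 : ((N : ℝ) - 1) * Real.exp (1 / N) ≤ N := by
      have e1 := Real.one_sub_le_exp_neg (1 / (N : ℝ))
      rw [Real.exp_neg, le_inv_comm₀ (by
        rw [sub_pos, div_lt_one (by linarith)]
        linarith) (Real.exp_pos _)] at e1
      have e2 : (1 - 1 / (N : ℝ))⁻¹ = N / (N - 1) := by
        have : (N : ℝ) - 1 ≠ 0 := by linarith
        field_simp
      rw [e2, le_div_iff₀ (by linarith)] at e1
      linarith
    have h4 : 1 ≤ Real.exp (1 / (N : ℝ)) := Real.one_le_exp (by positivity)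
    calc (SP ℤ M : ℝ) * Real.log n ^ ε ≤ (n - 1) * Real.exp (1 / N) :=
          mul_le_mul h1 h2 hpow.le (by linarith)
      _ = (N - 1) * Real.exp (1 / N) - (N - n) * Real.exp (1 / N) := by ring
      _ ≤ N - (N - n) * 1 := by
          have := mul_le_mul_of_nonneg_left h4 (sub_nonneg.2 hnN')
          linarith
      _ = n := by ring

/-! ### Consequence for sum-product estimates of sets -/

lemma SP_top_le_card {n : ℕ} {A : Finset ℤ} (hA : A.card = n) :
    SP ℤ (⊤ : SimpleGraph (Fin n)) ≤ max (A + A).card (A * A).card := by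
  let f : Fin n → ℤ := fun i => (A.equivFinOfCardEq hA).symm i
  have hf : Function.Injective f :=
    Subtype.val_injective.comp (A.equivFinOfCardEq hA).symm.injective
  have hmem : ∀ i, f i ∈ A := fun i => ((A.equivFinOfCardEq hA).symm i).2
  refine (SP_le _ hf).trans (max_le_max ?_ ?_) <;> rw [← Set.ncard_coe_finset] <;>
    refine Set.ncard_le_ncard ?_ (Finset.finite_toSet _)
  · rintro x ⟨u, v, -, rfl⟩
    exact Finset.mem_coe.2 (Finset.add_mem_add (hmem u) (hmem v))
  · rintro x ⟨u, v, -, rfl⟩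
    exact Finset.mem_coe.2 (Finset.mul_mem_mul (hmem u) (hmem v))

/-- The comparison with the complete graph turns exponent `1/2 + δ` for matchings into `1 + δ` for
sets. Below the threshold the constant is chosen so small that `|A + A| ≥ 1` suffices. -/
lemma exists_sum_product_bound {δ : ℝ} (hδ : 0 < δ)
    (h : ∃ c : ℝ, 0 < c ∧ ∃ n₀ : ℕ, ∀ n : ℕ, n₀ ≤ n → ∀ (V : Type u) (M : SimpleGraph V),
      IsMatchingOfSize M n → c * (n : ℝ) ^ (1 / 2 + δ) ≤ (SP ℤ M : ℝ)) :
    ∃ c' : ℝ, 0 < c' ∧ ∀ (n : ℕ) (A : Finset ℤ), A.card = n →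
      c' * (n : ℝ) ^ (1 + δ) ≤ (max (A + A).card (A * A).card : ℝ) := by
  obtain ⟨c, hc, n₀, h⟩ := h
  obtain ⟨N, hN⟩ : ∃ N, N = max n₀ 2 := ⟨_, rfl⟩
  have hN2 : 2 ≤ N := hN ▸ le_max_right _ _
  have hN0 : (0 : ℝ) < N := by positivity
  have hNpow : 0 < (N : ℝ) ^ (1 + δ) := Real.rpow_pos_of_pos hN0 _
  refine ⟨min (c / 40000) (1 / (N : ℝ) ^ (1 + δ)), lt_min (by positivity) (by positivity),
    fun n A hA => ?_⟩
  rcases Nat.eq_zero_or_pos n with rfl | hn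
  · rw [Nat.cast_zero, Real.zero_rpow (by linarith), mul_zero]
    exact le_max_of_le_left (Nat.cast_nonneg _)
  have hn0 : (0 : ℝ) < n := by exact_mod_cast hn
  rcases le_total N n with hNn | hnN
  -- The hypothesis speaks only about given matchings, so one of size `n` must be exhibited in the
  -- same universe.
  · obtain ⟨V, M, hM⟩ := exists_isMatchingOfSize.{u} n
    have h1 := h n (le_trans (hN ▸ le_max_left _ _) hNn) V M hM
    have h2 := h1.trans (SP_matching_le_SP_top (hN2.trans hNn) hM)
    have hsq0 : 0 < Real.sqrt n := Real.sqrt_pos.2 hn0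
    rw [← mul_div_assoc, le_div_iff₀ hsq0] at h2
    have h3 : (n : ℝ) ^ (1 / 2 + δ) * Real.sqrt n = (n : ℝ) ^ (1 + δ) := by
      rw [Real.sqrt_eq_rpow, ← Real.rpow_add hn0]
      congr 1
      ring
    rw [mul_assoc, h3] at h2
    have h4 : (SP ℤ (⊤ : SimpleGraph (Fin n)) : ℝ) ≤ (max (A + A).card (A * A).card : ℝ) := by
      exact_mod_cast SP_top_le_card hA
    refine le_trans ?_ h4
    calc min (c / 40000) (1 / (N : ℝ) ^ (1 + δ)) * (n : ℝ) ^ (1 + δ)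
        ≤ c / 40000 * (n : ℝ) ^ (1 + δ) := by
          gcongr
          exact min_le_left _ _
      _ ≤ _ := by linarith
  · have hne : A.Nonempty := Finset.card_pos.1 (hA ▸ hn)
    have h1 : (1 : ℝ) ≤ (A + A).card := by exact_mod_cast (hne.add hne).card_pos
    refine le_max_of_le_left (le_trans ?_ h1)
    calc min (c / 40000) (1 / (N : ℝ) ^ (1 + δ)) * (n : ℝ) ^ (1 + δ)
        ≤ 1 / (N : ℝ) ^ (1 + δ) * (N : ℝ) ^ (1 + δ) := by
          gcongr
          exact min_le_right _ _
      _ = 1 := one_div_mul_cancel hNpow.ne'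

theorem theorem1 :
    (∃ C : ℝ, 0 < C ∧ ∀ n : ℕ, 2 ≤ n → ∀ (V : Type u) (M : SimpleGraph V),
      IsMatchingOfSize M n →
        (SP ℤ M : ℝ) ≤ C * ((SP ℤ (⊤ : SimpleGraph (Fin n)) : ℝ) / Real.sqrt n)) ∧
    (∃ ε : ℝ, 0 < ε ∧ ∀ n : ℕ, 2 ≤ n → ∀ (V : Type u) (M : SimpleGraph V),
      IsMatchingOfSize M n →
        (SP ℤ M : ℝ) ≤ (n : ℝ) / (Real.log n) ^ ε) ∧
    (∀ δ : ℝ, 0 < δ →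
      (∃ c : ℝ, 0 < c ∧ ∃ n₀ : ℕ, ∀ n : ℕ, n₀ ≤ n → ∀ (V : Type u) (M : SimpleGraph V),
        IsMatchingOfSize M n → c * (n : ℝ) ^ (1 / 2 + δ) ≤ (SP ℤ M : ℝ)) →
      ∃ c' : ℝ, 0 < c' ∧ ∀ (n : ℕ) (A : Finset ℤ), A.card = n →
        c' * (n : ℝ) ^ (1 + δ) ≤ (max (A + A).card (A * A).card : ℝ)) := by
  exact ⟨⟨40000, by norm_num, fun n hn V M hM => SP_matching_le_SP_top hn hM⟩,
    exists_SP_matching_le_div_log, fun δ hδ h => exists_sum_product_bound hδ h⟩
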